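/- Let $B$ be a set with at least two elements. For a tuple $\mathbf a=(a_1,\dots,a_n)$ over a set $A$, let $\mathrm{ofo}(\mathbf a)$ be the tuple of pairwise distinct elements obtained from $\mathbf a$ by retaining only the first occurrence of each element, and let $A^\sharp$ be the set of all nonempty finite tuples of pairwise distinct elements of $A$. A function $f\colon A^n\to B$ is *determined by the order of first occurrence* if there is a map $f^*\colon A^\sharp\to B$ with $f(\mathbf a)=f^*(\mathrm{ofo}(\mathbf a))$ for all $\mathbf a\in A^n$. A function $f\colon A^n\to B$ is a *minor* of $g\colon A^m\to B$ if there is a map $\sigma\colon\{1,\dots,m\}\to\{1,\dots,n\}$ with $f(a_1,\dots,a_n)=g(a_{\sigma(1)},\dots,a_{\sigma(m)})$ for all $(a_1,\dots,a_n)\in A^n$; $f$ and $g$ are *equivalent* if each is a minor of the other. For integers $n,k\ge 2$, call the couple $(n,k)$ *equalizing* if for every set $A$ with $|A|=k$ and all functions $f,g\colon A^n\to B$ that are determined by the order of first occurrence, if $f$ and $g$ are equivalent, then $f=g$. Theorem. Let $n$ and $k$ be integers greater than or equal to $2$. The couple $(n,k)$ is equalizing if and only if $k\equiv 1,2\pmod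 4$ and $n\ge k+1$; or $k\equiv 0,3\pmod 4$ and $n\ge k+2$. -/

import Mathlib

universe u v

namespace FirstOccurrence

open Classical in
/-- The list of the elements of `l` in the order of their first occurrence: every repetition is
removed, and only the first occurrence of each element is retained. -/
noncomputable def ofoList {A : Type u} : List A → List A
  | [] => []
  | x :: l => x :: (ofoList l).filter (fun y => decide (y ≠ x))

theorem mem_ofoList {A : Type u} (l : List A) (y : A) : y ∈ ofoList l ↔ y ∈ l := by
  induction l with
  | nil => simp [ofoList]
  | cons x l ih =>
    by_cases h : y = x <;> simp [ofoList, ih, h]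

theorem nodup_ofoList {A : Type u} (l : List A) : (ofoList l).Nodup := by
  induction l with
  | nil => simp [ofoList]
  | cons x l ih =>
    simp only [ofoList, List.nodup_cons]
    exact ⟨by simp, ih.filter _⟩

open Classical in
/-- The entries of `ofoList l` are listed by strictly increasing position of their first
occurrence in `l`. With `mem_ofoList`, this characterizes `ofoList l`. -/
theorem pairwise_ofoList {A : Type u} (l : List A) :
    (ofoList l).Pairwise (fun x y => l.idxOf x < l.idxOf y) := by
  induction l with
  | nil => simp [ofoList]
  | cons x l ih =>
    simp only [ofoList, List.pairwise_cons]
    refine ⟨?_, ?_⟩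
    · intro y hy
      have hyx : y ≠ x := by simpa using (List.mem_filter.1 hy).2
      rw [List.idxOf_cons_self, List.idxOf_cons_ne _ hyx.symm]
      omega
    · refine List.Pairwise.imp_of_mem ?_ (ih.filter _)
      intro a b ha hb hab
      have hax : a ≠ x := by simpa using (List.mem_filter.1 ha).2
      have hbx : b ≠ x := by simpa using (List.mem_filter.1 hb).2
      rw [List.idxOf_cons_ne _ hax.symm, List.idxOf_cons_ne _ hbx.symm]
      omega

/-- The set `A^♯` of all finite tuples of pairwise distinct elements of `A`. (It contains the
empty tuple, which is the order of first occurrence only of the tuple of length `0`.) -/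
abbrev ASharp (A : Type u) : Type u := {l : List A // l.Nodup}

/-- The order of first occurrence of the `n`-tuple `a`. -/
noncomputable def ofo {A : Type u} {n : ℕ} (a : Fin n → A) : ASharp A :=
  ⟨ofoList (List.ofFn a), nodup_ofoList _⟩

/-- `f : A^n → B` is determined by the order of first occurrence. -/
def DeterminedByOfo {A : Type u} {B : Type v} {n : ℕ} (f : (Fin n → A) → B) : Prop :=
  ∃ fStar : ASharp A → B, ∀ a : Fin n → A, f a = fStar (ofo a)

/-- `f : A^n → B` is a minor of `g : A^m → B`. -/
def IsMinor {A : Type u} {B : Type v} {n m : ℕ}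
    (f : (Fin n → A) → B) (g : (Fin m → A) → B) : Prop :=
  ∃ σ : Fin m → Fin n, ∀ a : Fin n → A, f a = g (a ∘ σ)

/-- `f` and `g` are equivalent: each one is a minor of the other. -/
def Equivalent {A : Type u} {B : Type v} {n m : ℕ}
    (f : (Fin n → A) → B) (g : (Fin m → A) → B) : Prop :=
  IsMinor f g ∧ IsMinor g f

/-- The couple `(n, k)` is equalizing (with respect to the codomain `B`): for every set `A` with
`k` elements, any two equivalent functions `A^n → B` that are determined by the order of first
occurrence are equal. -/
def Equalizing (B : Type v) (n k : ℕ) : Prop :=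
  ∀ A : Type u, Nat.card A = k → ∀ f g : (Fin n → A) → B,
    DeterminedByOfo f → DeterminedByOfo g → Equivalent f g → f = g

end FirstOccurrence

/-! ### Orders of first occurrence as a relation between tuples -/

namespace FirstOccurrence

/-! Let `f a = g (a ∘ σ)`. If `σ` is not surjective, `f` has an inessential coordinate. Being
determined by first occurrences, `f` then depends on its first coordinate only, or is constant, and
`f = g` follows. So let `σ` be a permutation.

Fix `l` distinct letters. On tuples with exactly these letters, `f` and `g` become functions `F`,
`G` on the symmetric group of degree `l`, related by `Compatible`. Let `n = l + 1` and `s = σ⁻¹`. A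
tuple with one repetition, at `u < v`, gives `F θ = G (θ * ρ⁻¹)` with `ρ = mergePerm s u v`. Hence
all merges `ρ` lie in one coset `K κ` of the right stabilizer `K` of `G`, and `F = G` as soon as `κ
∈ K`.

Quotients of merges supply elements of `K`. When `s 0` is 0, or `s` exchanges 0 and 1, merging with
the point 0 yields (almost) all plain deletions `delPerm s v`. When `s 0 ≥ 2`, three-cycles and a
parity count make `K` large enough on the first block of `s` to put the deletions into the coset as
well (`delPerm_mem_of_two_le`). If `s 0 = 1` but `s 1 ≠ 0`, the roles of `σ` and `σ⁻¹` are
exchanged. Quotients of deletions and inversion merges are cyclic shifts of intervals. Either these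
produce enough adjacent transpositions to put a deletion into `K`, or `s` exchanges consecutive
pairs, possibly after a fixed first point (`good_or_pairs`). With an odd number of pairs, the
deletion of the last point is even and a chain of three-cycles puts it into `K`. With an even number
every merge is odd, and the sign gives a counterexample. That is the origin of the residues modulo
4.

For `n ≥ l + 2` the coordinates can be identified down to `l + 1` classes so that the exceptional
form is avoided. For `n ≤ k` the indicator of an injective tuple is a counterexample. -/

/-- `v` lists the entries of `p` in the order of their first occurrence: there are increasing
positions `φ i` with `p (φ i) = v i`, and every entry of `p` is preceded by such a position. -/
def IsOfo {X : Type*} {n l : ℕ} (p : Fin n → X) (v : Fin l → X) : Prop :=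
  ∃ φ : Fin l → Fin n, StrictMono φ ∧ (∀ i, p (φ i) = v i) ∧ ∀ j, ∃ i, p j = v i ∧ φ i ≤ j

theorem IsOfo.comp {X Y : Type*} {n l : ℕ} {p : Fin n → X} {v : Fin l → X} (h : IsOfo p v)
    (e : X → Y) : IsOfo (e ∘ p) (e ∘ v) := by
  obtain ⟨φ, hφ, h1, h2⟩ := h
  refine ⟨φ, hφ, fun i => congrArg e (h1 i), fun j => ?_⟩
  obtain ⟨i, hi, hij⟩ := h2 j
  exact ⟨i, congrArg e hi, hij⟩

/-- The order of first occurrence of `q ∘ m` only depends on that of `m`. -/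
theorem IsOfo.trans {X Y : Type*} {n N l : ℕ} {m : Fin n → X} {τ : Fin N → X} {q : X → Y}
    {v : Fin l → Y} (h : IsOfo m τ) (h' : IsOfo (q ∘ τ) v) : IsOfo (q ∘ m) v := by
  obtain ⟨φ, hφ, h1, h2⟩ := h
  obtain ⟨ψ, hψ, k1, k2⟩ := h'
  refine ⟨φ ∘ ψ, hφ.comp hψ, fun i => ?_, fun j => ?_⟩
  · simpa [h1] using k1 i
  · obtain ⟨i, hi, hij⟩ := h2 j
    obtain ⟨i', hi', hij'⟩ := k2 i
    exact ⟨i', by simpa [hi] using hi', (hφ.monotone hij').trans hij⟩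

theorem idxOf_getElem_le {X : Type*} [DecidableEq X] (l : List X) (j : ℕ) (hj : j < l.length) :
    l.idxOf l[j] ≤ j := by
  induction l generalizing j with
  | nil => simp at hj
  | cons x l ih =>
    cases j with
    | zero => simp
    | succ j =>
      simp only [List.getElem_cons_succ]
      by_cases h : x = l[j]'(by simpa using hj)
      · rw [List.idxOf_cons_eq _ h]; omega
      · rw [List.idxOf_cons_ne _ h]
        exact Nat.succ_le_succ (ih j (by simpa using hj))

-- The first index of `v i` in `p` is `φ i`, so both lists are strictly sorted by first index in `p`
-- and have the same members.
open Classical in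
theorem IsOfo.ofoList_eq {X : Type*} {n l : ℕ} {p : Fin n → X} {v : Fin l → X} (h : IsOfo p v)
    (hv : Function.Injective v) : ofoList (List.ofFn p) = List.ofFn v := by
  obtain ⟨φ, hφ, h1, h2⟩ := h
  have key : ∀ i, (List.ofFn p).idxOf (v i) = φ i := by
    intro i
    have hmem : v i ∈ List.ofFn p := by rw [List.mem_ofFn]; exact ⟨φ i, h1 i⟩
    have hlt := List.idxOf_lt_length_of_mem hmem
    have hlt' : (List.ofFn p).idxOf (v i) < n := by simpa using hlt
    have hget : p ⟨(List.ofFn p).idxOf (v i), hlt'⟩ = v i := by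
      have := List.idxOf_get hlt
      rwa [List.get_ofFn] at this
    obtain ⟨i', hi', hle⟩ := h2 ⟨_, hlt'⟩
    have : i' = i := hv (hi'.symm.trans hget)
    subst this
    have h3 := idxOf_getElem_le (List.ofFn p) (φ i') (by simp)
    simp only [List.getElem_ofFn, Fin.eta, h1] at h3
    exact le_antisymm h3 hle
  refine List.Perm.eq_of_pairwise (le := fun x y => (List.ofFn p).idxOf x < (List.ofFn p).idxOf y)
    ?_ (pairwise_ofoList _) ?_ ?_
  · intro a b _ _ hab hba; omega
  · rw [List.pairwise_ofFn]
    intro i j hij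
    rw [key, key]
    exact hφ hij
  · rw [List.perm_ext_iff_of_nodup (nodup_ofoList _) (List.nodup_ofFn.2 hv)]
    intro a
    rw [mem_ofoList, List.mem_ofFn, List.mem_ofFn]
    constructor
    · rintro ⟨j, rfl⟩
      obtain ⟨i, hi, -⟩ := h2 j
      exact ⟨i, hi.symm⟩
    · rintro ⟨i, rfl⟩
      exact ⟨φ i, h1 i⟩

open Classical in
theorem exists_isOfo {X : Type*} {n : ℕ} (p : Fin n → X) :
    ∃ (l : ℕ) (v : Fin l → X), Function.Injective v ∧ IsOfo p v := by
  set w := ofoList (List.ofFn p) with hw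
  have hnd : w.Nodup := nodup_ofoList _
  have hlt : ∀ i : Fin w.length, (List.ofFn p).idxOf (w.get i) < n := by
    intro i
    have : w.get i ∈ List.ofFn p := (mem_ofoList _ _).1 (List.get_mem w i)
    simpa using List.idxOf_lt_length_of_mem this
  refine ⟨w.length, w.get, List.nodup_iff_injective_get.1 hnd, fun i => ⟨_, hlt i⟩, ?_, ?_, ?_⟩
  · intro i j hij
    exact List.pairwise_iff_get.1 (pairwise_ofoList (List.ofFn p)) i j hij
  · intro i
    have : w.get i ∈ List.ofFn p := (mem_ofoList _ _).1 (List.get_mem w i)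
    have := List.idxOf_get (List.idxOf_lt_length_of_mem this)
    rwa [List.get_ofFn] at this
  · intro j
    have : p j ∈ w := (mem_ofoList _ _).2 (List.mem_ofFn.2 ⟨j, rfl⟩)
    obtain ⟨i, hi⟩ := List.get_of_mem this
    refine ⟨i, hi.symm, ?_⟩
    have h3 := idxOf_getElem_le (List.ofFn p) j (by simp)
    simp only [List.getElem_ofFn, Fin.eta] at h3
    rw [Fin.le_def]
    simpa [← hi] using h3

theorem IsOfo.ofo_eq {X : Type u} {n l : ℕ} {p : Fin n → X} {v : Fin l → X} (h : IsOfo p v)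
    (hv : Function.Injective v) : ofo p = ⟨List.ofFn v, List.nodup_ofFn.2 hv⟩ :=
  Subtype.ext (h.ofoList_eq hv)

/-- The order of first occurrence of a surjective labelling is a permutation of the labels. -/
theorem exists_perm_isOfo {n l : ℕ} (p : Fin n → Fin l) (hp : Function.Surjective p) :
    ∃ π : Equiv.Perm (Fin l), IsOfo p π := by
  obtain ⟨l', v, hv, h⟩ := exists_isOfo p
  have hs : Function.Surjective v := by
    intro y
    obtain ⟨j, rfl⟩ := hp y
    obtain ⟨φ, -, -, h2⟩ := h
    obtain ⟨i, hi, -⟩ := h2 j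
    exact ⟨i, hi.symm⟩
  have hc : l' = l := by simpa using Fintype.card_of_bijective ⟨hv, hs⟩
  subst hc
  exact ⟨Equiv.ofBijective v ⟨hv, hs⟩, h⟩

theorem DeterminedByOfo.eq_of_isOfo {A : Type u} {B : Type v} {n l : ℕ} {f : (Fin n → A) → B}
    (hf : DeterminedByOfo f) {a b : Fin n → A} {w : Fin l → A} (hw : Function.Injective w)
    (ha : IsOfo a w) (hb : IsOfo b w) : f a = f b := by
  obtain ⟨F, hF⟩ := hf
  rw [hF, hF, ha.ofo_eq hw, hb.ofo_eq hw]

/-! ### Inessential coordinates and non-surjective minors -/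

/-- `f` does not depend on the coordinate `p`. -/
def Inessential {A : Type u} {B : Type v} {n : ℕ} (f : (Fin n → A) → B) (p : Fin n) : Prop :=
  ∀ a x, f (Function.update a p x) = f a

theorem isOfo_const {A : Type u} {n : ℕ} [NeZero n] (c : A) :
    IsOfo (fun _ : Fin n => c) (fun _ : Fin 1 => c) :=
  ⟨fun _ => 0, fun i j h => absurd h (by simp [Subsingleton.elim i j]), fun _ => rfl,
    fun _ => ⟨0, rfl, Fin.zero_le _⟩⟩

theorem card_le_of_isOfo {A : Type u} {n l : ℕ} {a : Fin n → A} {w : Fin l → A}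
    (h : IsOfo a w) : l ≤ n := by
  obtain ⟨φ, hφ, -⟩ := h
  simpa using Fintype.card_le_of_injective φ hφ.injective

/-- A function determined by the order of first occurrence that does not depend on some
coordinate other than the first one depends on the first coordinate only. -/
theorem eq_const_of_inessential {A : Type u} {B : Type v} {n : ℕ} [NeZero n]
    {f : (Fin n → A) → B} (hf : DeterminedByOfo f) {p : Fin n} (hp : p ≠ 0)
    (hfp : Inessential f p) (a : Fin n → A) : f a = f (fun _ => a 0) := by
  have key : ∀ (l : ℕ) (w : Fin (l + 1) → A), Function.Injective w → ∀ a, IsOfo a w →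
      f a = f (fun _ => w 0) := by
    intro l
    induction l with
    | zero =>
      intro w hw a ha
      have : w = fun _ => w 0 := funext fun i => congrArg w (by omega)
      exact hf.eq_of_isOfo hw ha (this ▸ isOfo_const (w 0))
    | succ l ih =>
      intro w hw a ha
      have hn := card_le_of_isOfo ha
      -- The letters of `w` are placed on `l + 2` positions that include `0` and `p`, and every
      -- other position is filled with `w 0`. Overwriting position `p` by `w 0` then erases one
      -- letter other than the first.
      obtain ⟨T, hT1, -, hT3⟩ := Finset.exists_subsuperset_card_eq (n := l + 2)
        (Finset.subset_univ ({0, p} : Finset (Fin n)))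
        ((Finset.card_le_two).trans (by omega)) (by rw [Finset.card_fin]; exact hn)
      set φ := T.orderEmbOfFin hT3 with hφ
      have hrange : ∀ x ∈ T, ∃ i, φ i = x := by
        intro x hx
        have : x ∈ Set.range φ := by rw [hφ, Finset.range_orderEmbOfFin]; exact hx
        exact this
      obtain ⟨i0, hi0⟩ := hrange 0 (hT1 (by simp))
      obtain ⟨t, ht⟩ := hrange p (hT1 (by simp))
      have hi00 : i0 = 0 := by
        have : φ i0 ≤ φ 0 := by rw [hi0]; exact Fin.zero_le _
        simpa using φ.le_iff_le.1 this
      subst hi00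
      have ht0 : t ≠ 0 := by rintro rfl; exact hp (ht.symm.trans hi0)
      classical
      set a' : Fin n → A := fun x => if h : ∃ i, φ i = x then w h.choose else w 0 with ha'
      have ha'φ : ∀ i, a' (φ i) = w i := by
        intro i
        have h : ∃ j, φ j = φ i := ⟨i, rfl⟩
        simp only [ha', dif_pos h]
        congr 1
        exact φ.injective h.choose_spec
      have ha'n : ∀ x, (¬ ∃ i, φ i = x) → a' x = w 0 := fun x h => by simp only [ha', dif_neg h]
      have h1 : IsOfo a' w := by
        refine ⟨φ, φ.strictMono, ha'φ, fun x => ?_⟩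
        by_cases h : ∃ i, φ i = x
        · obtain ⟨i, rfl⟩ := h
          exact ⟨i, ha'φ i, le_rfl⟩
        · exact ⟨0, ha'n x h, by rw [hi0]; exact Fin.zero_le _⟩
      have hs0 : t.succAbove 0 = 0 := Fin.succAbove_ne_zero_zero ht0
      have h2 : IsOfo (Function.update a' p (w 0)) (w ∘ t.succAbove) := by
        refine ⟨φ ∘ t.succAbove, φ.strictMono.comp (Fin.strictMono_succAbove t), fun i => ?_,
          fun x => ?_⟩
        · have : φ (t.succAbove i) ≠ p := by
            rw [← ht]; exact fun h => Fin.succAbove_ne t i (φ.injective h)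
          simp [Function.update_of_ne this, ha'φ]
        · by_cases hx : x = p
          · subst hx
            exact ⟨0, by simp [hs0], by simp [hs0, hi0]⟩
          · rw [Function.update_of_ne hx]
            by_cases h : ∃ i, φ i = x
            · obtain ⟨i, rfl⟩ := h
              have : i ≠ t := by rintro rfl; exact hx ht
              obtain ⟨j, rfl⟩ := Fin.exists_succAbove_eq this
              exact ⟨j, ha'φ _, le_rfl⟩
            · exact ⟨0, by simp [hs0, ha'n x h], by simp [hs0, hi0]⟩
      rw [hf.eq_of_isOfo hw ha h1, ← hfp a' (w 0),
        ih _ (hw.comp Fin.succAbove_right_injective) _ h2]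
      simp [hs0]
  obtain ⟨l, w, hw, hwa⟩ := exists_isOfo a
  obtain ⟨φ, hφ, h1, h2⟩ := id hwa
  obtain ⟨i, hi, hi0⟩ := h2 0
  obtain _ | l := l
  · exact i.elim0
  have : i = 0 := by
    have h3 : φ i ≤ φ 0 := hi0.trans (Fin.zero_le _)
    simpa using hφ.le_iff_le.1 h3
  subst this
  rw [hi]
  exact key l w hw a hwa

/-- A function determined by the order of first occurrence that does not depend on its first
coordinate is constant. -/
theorem eq_of_inessential_zero {A : Type u} {B : Type v} {n : ℕ} [NeZero n] (hn : 3 ≤ n)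
    {f : (Fin n → A) → B} (hf : DeterminedByOfo f)
    (hf0 : Inessential f 0) (a b : Fin n → A) : f a = f b := by
  have hinj : ∀ c d : A, c ≠ d → Function.Injective ![c, d] := by
    intro c d h i j hij
    fin_cases i <;> fin_cases j <;> simp_all
  have hval0 : ((0 : Fin n) : ℕ) = 0 := rfl
  have htwo : ∀ c d : A, c ≠ d → ∀ x : Fin n, x ≠ 0 → ∀ p : Fin n → A, p 0 = c → p x = d →
      (∀ y, p y = c ∨ (p y = d ∧ x ≤ y)) → IsOfo p ![c, d] := by
    intro c d h x hx p h0 h1 h2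
    refine ⟨![0, x], ?_, ?_, ?_⟩
    · intro i j hij
      fin_cases i <;> fin_cases j <;> simp_all [Fin.pos_iff_ne_zero]
    · intro i; fin_cases i <;> simp [h0, h1]
    · intro y
      rcases h2 y with h | h
      · exact ⟨0, by simpa using h, by simp⟩
      · exact ⟨1, by simpa using h.1, by simpa using h.2⟩
  have hdrop : ∀ c d : A, f (fun x => if x = 0 then c else d) = f (fun _ => d) := by
    intro c d
    rw [← hf0 _ d]
    congr 1
    funext x
    by_cases hx : x = 0 <;> simp [hx]
  have hone : ∀ c d : A, f (fun _ => c) = f (fun _ => d) := by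
    intro c d
    by_cases hcd : c = d
    · rw [hcd]
    have h1 : (⟨1, by omega⟩ : Fin n) ≠ 0 := by simp [Fin.ext_iff]
    have h2 : (⟨2, by omega⟩ : Fin n) ≠ 0 := by simp [Fin.ext_iff]
    have h12 : (⟨1, by omega⟩ : Fin n) ≠ ⟨2, by omega⟩ := by simp [Fin.ext_iff]
    -- The tuple `(c, c, d, c, ...)` has the order of `(c, d, ..., d)`. Replacing its first entry by
    -- `d` gives the order of `(d, c, ..., c)`. Dropping first letters in both identifies the two
    -- constants; the position `2` is where `3 ≤ n` is needed.
    set q : Fin n → A := fun x => if x = ⟨2, by omega⟩ then d else c with hq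
    have e1 : f (fun x => if x = 0 then c else d) = f q := by
      refine hf.eq_of_isOfo (hinj c d hcd) (htwo c d hcd ⟨1, by omega⟩ h1 _ ?_ ?_ ?_)
        (htwo c d hcd ⟨2, by omega⟩ h2 _ ?_ ?_ ?_)
      · simp
      · simp [h1]
      · intro y
        by_cases hy : y = 0
        · simp [hy]
        · right
          have : (y : ℕ) ≠ 0 := fun h => hy (Fin.ext h)
          exact ⟨by simp [hy], by rw [Fin.le_def]; simp only; omega⟩
      · simp [hq, h2.symm]
      · simp [hq]
      · intro y
        by_cases hy : y = ⟨2, by omega⟩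
        · right; exact ⟨by simp [hq, hy], hy.ge⟩
        · left; simp [hq, hy]
    have e2 : f (fun x => if x = 0 then d else c) = f (Function.update q 0 d) := by
      refine hf.eq_of_isOfo (hinj d c (Ne.symm hcd))
        (htwo d c (Ne.symm hcd) ⟨1, by omega⟩ h1 _ ?_ ?_ ?_)
        (htwo d c (Ne.symm hcd) ⟨1, by omega⟩ h1 _ ?_ ?_ ?_)
      · simp
      · simp [h1]
      · intro y
        by_cases hy : y = 0
        · simp [hy]
        · right
          have : (y : ℕ) ≠ 0 := fun h => hy (Fin.ext h)
          exact ⟨by simp [hy], by rw [Fin.le_def]; simp only; omega⟩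
      · simp
      · simp [hq, h12]
      · intro y
        by_cases hy : y = 0
        · simp [hy]
        · rw [Function.update_of_ne hy]
          by_cases hy2 : y = ⟨2, by omega⟩
          · left; simp [hq, hy2]
          · right
            have : (y : ℕ) ≠ 0 := fun h => hy (Fin.ext h)
            exact ⟨by simp [hq, hy2], by rw [Fin.le_def]; simp only; omega⟩
    rw [← hdrop d c, e2, hf0, ← e1, hdrop]
  have key : ∀ (l : ℕ) (w : Fin (l + 1) → A), Function.Injective w → ∀ a, IsOfo a w →
      ∃ c, f a = f (fun _ => c) := by
    intro l
    induction l with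
    | zero =>
      intro w hw a ha
      have : w = fun _ => w 0 := funext fun i => congrArg w (by omega)
      exact ⟨w 0, hf.eq_of_isOfo hw ha (this ▸ isOfo_const (w 0))⟩
    | succ l ih =>
      intro w hw a ha
      have hle := card_le_of_isOfo ha
      -- Padding with the second letter: overwriting position `0` by `w 1` removes `w 0` and leaves
      -- the other letters in order.
      set a' : Fin n → A := fun x => if h : x.val < l + 2 then w ⟨x, h⟩ else w 1 with ha'
      have ha'φ : ∀ i : Fin (l + 2), a' (Fin.castLE hle i) = w i := fun i => by simp [ha']
      have h1 : IsOfo a' w := by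
        refine ⟨Fin.castLE hle, Fin.strictMono_castLE hle, ha'φ, fun x => ?_⟩
        by_cases hx : x.val < l + 2
        · exact ⟨⟨x, hx⟩, by simp [ha', hx], by rw [Fin.le_def]; simp⟩
        · exact ⟨1, by simp [ha', hx], by rw [Fin.le_def]; simp; omega⟩
      have h2 : IsOfo (Function.update a' 0 (w 1)) (w ∘ Fin.succ) := by
        refine ⟨fun i => if i = 0 then 0 else Fin.castLE hle i.succ, ?_, ?_, ?_⟩
        · intro i j hij
          have hj : j ≠ 0 := by rintro rfl; simp at hij
          by_cases hi : i = 0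
          · dsimp only
            rw [if_pos hi, if_neg hj, Fin.lt_def]
            exact Nat.succ_pos _
          · dsimp only
            rw [if_neg hi, if_neg hj, Fin.lt_def]
            exact Nat.succ_lt_succ hij
        · intro i
          by_cases hi : i = 0
          · simp [hi]
          · have : Fin.castLE hle i.succ ≠ 0 := fun h => Nat.succ_ne_zero _ (congrArg Fin.val h)
            simp [hi, Function.update_of_ne this, ha'φ]
        · intro x
          by_cases hx : x = 0
          · exact ⟨0, by simp [hx], by simp⟩
          · rw [Function.update_of_ne hx]
            by_cases hx2 : x.val < l + 2
            · have : (x : ℕ) ≠ 0 := fun h => hx (Fin.ext h)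
              refine ⟨⟨x - 1, by omega⟩, ?_, ?_⟩
              · simp only [ha', dif_pos hx2, Function.comp]
                congr 1
                simp only [Fin.ext_iff, Fin.val_succ]
                omega
              · dsimp only
                split_ifs
                · exact Fin.zero_le _
                · rw [Fin.le_def]; simp; omega
            · exact ⟨0, by simp [ha', hx2], by simp⟩
      obtain ⟨c, hc⟩ := ih _ (hw.comp (Fin.succ_injective _)) _ h2
      exact ⟨c, by rw [hf.eq_of_isOfo hw ha h1, ← hf0 a' (w 1), hc]⟩
  have hall : ∀ a : Fin n → A, ∃ c, f a = f (fun _ => c) := by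
    intro a
    obtain ⟨l, w, hw, hwa⟩ := exists_isOfo a
    obtain _ | l := l
    · obtain ⟨_, _, _, h2⟩ := hwa
      exact (h2 0).choose.elim0
    · exact key l w hw a hwa
  obtain ⟨c, hc⟩ := hall a
  obtain ⟨d, hd⟩ := hall b
  rw [hc, hd, hone c d]

/-- Two equivalent functions determined by the order of first occurrence coincide if one of them
is a minor of the other via a map that is not surjective. -/
theorem eq_of_not_surjective {A : Type u} {B : Type v} {n : ℕ} (hn : 3 ≤ n)
    {f g : (Fin n → A) → B} (hf : DeterminedByOfo f) (hg : DeterminedByOfo g)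
    {σ τ : Fin n → Fin n} (hσ : ∀ a, f a = g (a ∘ σ)) (hτ : ∀ a, g a = f (a ∘ τ))
    (hns : ¬ Function.Surjective σ) : f = g := by
  have : NeZero n := ⟨by omega⟩
  have hne : ∀ (h : (Fin n → A) → B) (ρ : Fin n → Fin n) (p : Fin n), (∀ i, ρ i ≠ p) →
      ∀ h' : (Fin n → A) → B, (∀ a, h a = h' (a ∘ ρ)) → Inessential h p := by
    intro h ρ p hp h' hh a x
    rw [hh, hh]
    congr 1
    funext i
    simp [Function.update_of_ne (hp i)]
  simp only [Function.Surjective, not_forall, not_exists] at hns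
  obtain ⟨p, hp⟩ := hns
  have hfp := hne f σ p hp g hσ
  funext a
  by_cases hp0 : p = 0
  · subst hp0
    rw [hτ]
    exact eq_of_inessential_zero hn hf hfp _ _
  · have h1 := eq_const_of_inessential hf hp0 hfp
    have h2 : ∀ a, g a = f (fun _ => a (τ 0)) := fun a => by rw [hτ, h1]; rfl
    by_cases ht : τ 0 = 0
    · rw [h1, h2, ht]
    · have hg0 : Inessential g 0 := by
        intro a x
        rw [h2, h2, Function.update_of_ne ht]
      rw [hσ]
      exact eq_of_inessential_zero hn hg hg0 _ _

end FirstOccurrence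

/-! ### Transpositions and three-cycles in a permutation group -/

namespace FirstOccurrence

open Equiv Equiv.Perm

section Swaps

variable {X : Type*} [DecidableEq X] {K : Subgroup (Perm X)}

/-- The transpositions in `K` generate the full symmetric group on each class of points that they
connect. -/
theorem mem_of_forall_swap_mem [Finite X] (K : Subgroup (Perm X)) (f : Perm X) (hf : ∀ x, swap x (f x) ∈ K) : f ∈ K := by
  have hle : Subgroup.closure {σ : Perm X | σ ∈ K ∧ σ.IsSwap} ≤ K :=
    (Subgroup.closure_le K).2 fun σ hσ => hσ.1
  refine hle ((mem_closure_isSwap fun σ hσ => hσ.2).2 ⟨Set.toFinite _, fun x => ?_⟩)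
  by_cases h : x = f x
  · rw [← h]; exact MulAction.mem_orbit_self x
  · exact ⟨⟨swap x (f x), Subgroup.subset_closure ⟨hf x, x, f x, h, rfl⟩⟩, swap_apply_left x (f x)⟩

theorem swap_self_mem (x : X) : swap x x ∈ K := by
  rw [swap_self]; exact K.one_mem

theorem swap_mem_trans {i j k : X} (h : swap i j ∈ K) (h' : swap j k ∈ K) : swap i k ∈ K :=
  SubmonoidClass.swap_mem_trans K h h'

theorem swap_mem_symm {i j : X} (h : swap i j ∈ K) : swap j i ∈ K := by rwa [swap_comm]

theorem swap_mem_map {i j : X} {π : Perm X} (hπ : π ∈ K) (h : swap i j ∈ K) :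
    swap (π i) (π j) ∈ K := by
  rw [swap_apply_apply]
  exact K.mul_mem (K.mul_mem hπ h) (K.inv_mem hπ)

theorem swap_mem_of_map {i j : X} {π : Perm X} (hπ : π ∈ K) (h : swap (π i) (π j) ∈ K) :
    swap i j ∈ K := by
  have := swap_mem_map (K.inv_mem hπ) h
  simpa using this

/-- The points `c` such that the permutation `(a b)(b c)` belongs to `K`, together with `a`
and `b`. -/
def threeSet (K : Subgroup (Perm X)) (a b : X) : Set X :=
  {c | c = a ∨ c = b ∨ swap a b * swap b c ∈ K}

theorem left_mem_threeSet (a b : X) : a ∈ threeSet K a b := Or.inl rfl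

theorem right_mem_threeSet (a b : X) : b ∈ threeSet K a b := Or.inr (Or.inl rfl)

/-- The subgroup of `K` generated by the three-cycles through `a` and `b`, extended by the
transposition of `a` and `b`. -/
def threeExt (K : Subgroup (Perm X)) (a b : X) : Subgroup (Perm X) where
  carrier := {π | (π ∈ K ∧ swap a b * π * swap a b ∈ K) ∨
    (π * swap a b ∈ K ∧ swap a b * π ∈ K)}
  one_mem' := Or.inl ⟨K.one_mem, by simp [K.one_mem]⟩
  mul_mem' := by
    rintro x y (⟨h1, h2⟩ | ⟨h1, h2⟩) (⟨h3, h4⟩ | ⟨h3, h4⟩)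
    · exact Or.inl ⟨K.mul_mem h1 h3, by simpa [mul_assoc] using K.mul_mem h2 h4⟩
    · exact Or.inr ⟨by simpa [mul_assoc] using K.mul_mem h1 h3,
        by simpa [mul_assoc] using K.mul_mem h2 h4⟩
    · exact Or.inr ⟨by simpa [mul_assoc] using K.mul_mem h1 h4,
        by simpa [mul_assoc] using K.mul_mem h2 h3⟩
    · exact Or.inl ⟨by simpa [mul_assoc] using K.mul_mem h1 h4,
        by simpa [mul_assoc] using K.mul_mem h2 h3⟩
  inv_mem' := by
    rintro x (⟨h1, h2⟩ | ⟨h1, h2⟩)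
    · exact Or.inl ⟨K.inv_mem h1, by simpa [mul_assoc] using K.inv_mem h2⟩
    · exact Or.inr ⟨by simpa [mul_assoc] using K.inv_mem h2,
        by simpa [mul_assoc] using K.inv_mem h1⟩

theorem swap_mem_threeExt {a b c : X} (hab : a ≠ b) (hc : c ∈ threeSet K a b) :
    swap b c ∈ threeExt K a b := by
  rcases hc with rfl | rfl | h
  · exact Or.inr ⟨by simp [swap_comm b c, K.one_mem], by simp [swap_comm b c, K.one_mem]⟩
  · rw [swap_self]; exact (threeExt K a c).one_mem
  · refine Or.inr ⟨?_, h⟩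
    have := K.inv_mem h
    simpa using this

/-- `threeExt K a b` contains the transpositions `swap b c` with `c` in `threeSet K a b`, hence
every permutation supported on that set. So `π` or `π * swap a b` lies in `K`. -/
theorem mem_threeExt [Finite X] {a b : X} (hab : a ≠ b) {π : Perm X}
    (hπ : ∀ x, π x ≠ x → x ∈ threeSet K a b) : π ∈ threeExt K a b := by
  refine mem_of_forall_swap_mem _ π fun x => ?_
  by_cases hx : π x = x
  · rw [hx]; exact swap_self_mem x
  · have h1 := swap_mem_threeExt hab (hπ x hx)
    have h2 := swap_mem_threeExt hab (hπ (π x) fun h => hx (π.injective h))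
    exact swap_mem_trans (swap_mem_symm h1) h2

theorem swap_mem_of_mem_threeSet {a b c : X} (hab : swap a b ∈ K) (hc : c ∈ threeSet K a b) :
    swap a c ∈ K := by
  rcases hc with rfl | rfl | h
  · exact swap_self_mem _
  · exact hab
  · refine swap_mem_trans hab ?_
    have := K.mul_mem hab h
    simpa using this

theorem swap_mul_swap_mem_map {i j k : X} {π : Perm X} (hπ : π ∈ K)
    (h : swap i j * swap j k ∈ K) : swap (π i) (π j) * swap (π j) (π k) ∈ K := by
  have := K.mul_mem (K.mul_mem hπ h) (K.inv_mem hπ)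
  rw [swap_apply_apply π i j, swap_apply_apply π j k]
  simpa [mul_assoc] using this

variable [Fintype X]

/-- The defining products are even, so `K` may be replaced by its even part. The sign of `π` then
decides which alternative of `threeExt` holds. -/
theorem threeSet_subset_inf_alternating {a b : X} (hab : a ≠ b) :
    threeSet K a b ⊆ threeSet (K ⊓ alternatingGroup X) a b := by
  rintro c (rfl | rfl | h)
  · exact left_mem_threeSet _ _
  · exact right_mem_threeSet _ _
  · by_cases hbc : c = b
    · exact Or.inr (Or.inl hbc)
    · refine Or.inr (Or.inr (Subgroup.mem_inf.2 ⟨h, ?_⟩))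
      rw [mem_alternatingGroup, Perm.sign_mul, sign_swap hab, sign_swap (Ne.symm hbc)]
      simp

/-- An even permutation moving only points of `threeSet K a b` belongs to `K`. -/
theorem mem_of_sign_eq_one {a b : X} (hab : a ≠ b) {π : Perm X} (hs : sign π = 1)
    (hπ : ∀ x, π x ≠ x → x ∈ threeSet K a b) : π ∈ K := by
  rcases mem_threeExt hab fun x hx => threeSet_subset_inf_alternating hab (hπ x hx) with h | h
  · exact h.1.1
  · have := (Subgroup.mem_inf.1 h.1).2
    rw [mem_alternatingGroup, Perm.sign_mul, hs, sign_swap hab] at this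
    exact absurd this (by decide)

/-- If `K` contains an odd permutation moving only points of `threeSet K a b`, then it contains
the transposition of `a` and `b`. -/
theorem swap_mem_of_sign_ne_one {a b : X} (hab : a ≠ b) {π : Perm X} (hK : π ∈ K)
    (hs : sign π ≠ 1) (hπ : ∀ x, π x ≠ x → x ∈ threeSet K a b) : swap a b ∈ K := by
  rcases mem_threeExt hab fun x hx => threeSet_subset_inf_alternating hab (hπ x hx) with h | h
  · exact absurd (mem_alternatingGroup.1 (Subgroup.mem_inf.1 h.1).2) hs
  · have := K.mul_mem (K.inv_mem hK) h.1.1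
    simpa using this

/-- If `K` contains a permutation mapping `j` and `k` into `threeSet K a b`, then it also maps
`i` into that set, for any points `i`, `j`, `k` of the set with `k ≠ i, j`. -/
theorem map_mem_threeSet {a b : X} (hab : a ≠ b) {π : Perm X} (hπ : π ∈ K) {i j k : X}
    (hik : i ≠ k) (hjk : j ≠ k) (hi : i ∈ threeSet K a b) (hj : j ∈ threeSet K a b)
    (hk : k ∈ threeSet K a b) (hj' : π j ∈ threeSet K a b) (hk' : π k ∈ threeSet K a b) :
    π i ∈ threeSet K a b := by
  by_contra hq
  have hqa : π i ≠ a := fun h => hq (by rw [h]; exact left_mem_threeSet a b)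
  have hqb : π i ≠ b := fun h => hq (by rw [h]; exact right_mem_threeSet a b)
  -- Conjugating this three-cycle by `π` gives one through `π j`, `π k`, `π i`. An even `θ`
  -- supported on the set carries `π j`, `π k` to `a`, `b` in some order and fixes `π i`, which
  -- forces `π i` into the set.
  have h1 : swap j k * swap k i ∈ K := by
    refine mem_of_sign_eq_one hab ?_ ?_
    · rw [Perm.sign_mul, sign_swap hjk, sign_swap (Ne.symm hik)]; simp
    · intro x hx
      by_contra hxT
      have e1 : x ≠ i := fun h => hxT (h ▸ hi)
      have e2 : x ≠ j := fun h => hxT (h ▸ hj)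
      have e3 : x ≠ k := fun h => hxT (h ▸ hk)
      exact hx (by rw [Perm.mul_apply, swap_apply_of_ne_of_ne e3 e1, swap_apply_of_ne_of_ne e2 e3])
  have h2 : swap (π j) (π k) * swap (π k) (π i) ∈ K :=
    swap_mul_swap_mem_map hπ h1
  have hjk' : π j ≠ π k := π.injective.ne hjk
  -- a permutation of the set mapping `π j`, `π k` to `a`, `b` in some order
  obtain ⟨θ, hθ, hθs, hθab⟩ : ∃ θ : Perm X, (∀ x, θ x ≠ x → x ∈ threeSet K a b) ∧ sign θ = 1 ∧
      ((θ (π j) = a ∧ θ (π k) = b) ∨ (θ (π j) = b ∧ θ (π k) = a)) := by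
    set θ₀ : Perm X := swap b (swap a (π j) (π k)) * swap a (π j) with hθ₀
    have hk0 : swap a (π j) (π k) ≠ a := by
      intro h
      exact hjk' ((swap a (π j)).injective (by rw [h, swap_apply_right]))
    have hkm : swap a (π j) (π k) ∈ threeSet K a b := by
      rw [swap_apply_def]
      split_ifs
      · exact hj'
      · exact left_mem_threeSet _ _
      · exact hk'
    have hj0 : θ₀ (π j) = a := by
      rw [hθ₀, Perm.mul_apply, swap_apply_right, swap_apply_of_ne_of_ne hab (Ne.symm hk0)]
    have hk0' : θ₀ (π k) = b := by
      rw [hθ₀, Perm.mul_apply, swap_apply_right]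
    have hsupp : ∀ x, x ∉ threeSet K a b → θ₀ x = x := by
      intro x hx
      have e1 : x ≠ a := fun h => hx (h ▸ left_mem_threeSet _ _)
      have e2 : x ≠ b := fun h => hx (h ▸ right_mem_threeSet _ _)
      have e3 : x ≠ π j := fun h => hx (h ▸ hj')
      have e4 : x ≠ swap a (π j) (π k) := fun h => hx (h ▸ hkm)
      rw [hθ₀, Perm.mul_apply, swap_apply_of_ne_of_ne e1 e3, swap_apply_of_ne_of_ne e2 e4]
    rcases Int.units_eq_one_or (sign θ₀) with hs | hs
    · exact ⟨θ₀, fun x hx => by_contra fun h => hx (hsupp x h), hs, Or.inl ⟨hj0, hk0'⟩⟩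
    · refine ⟨swap a b * θ₀, fun x hx => by_contra fun h => hx ?_, ?_, Or.inr ⟨?_, ?_⟩⟩
      · have e1 : x ≠ a := fun h' => h (h' ▸ left_mem_threeSet _ _)
        have e2 : x ≠ b := fun h' => h (h' ▸ right_mem_threeSet _ _)
        rw [Perm.mul_apply, hsupp x h, swap_apply_of_ne_of_ne e1 e2]
      · rw [Perm.sign_mul, hs, sign_swap hab]; simp
      · rw [Perm.mul_apply, hj0, swap_apply_left]
      · rw [Perm.mul_apply, hk0', swap_apply_right]
  have hθK : θ ∈ K := mem_of_sign_eq_one hab hθs hθ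
  have hθq : θ (π i) = π i := by_contra fun h => hq (hθ _ h)
  have h3 : swap (θ (π j)) (θ (π k)) * swap (θ (π k)) (θ (π i)) ∈ K :=
    swap_mul_swap_mem_map hθK h2
  rw [hθq] at h3
  rcases hθab with ⟨e1, e2⟩ | ⟨e1, e2⟩ <;> rw [e1, e2] at h3
  · exact hq (Or.inr (Or.inr h3))
  · refine hq (Or.inr (Or.inr ?_))
    have h4 := K.inv_mem h3
    have : swap a b * swap b (π i) = (swap b a * swap a (π i))⁻¹ := by
      rw [mul_inv_rev, swap_inv, swap_inv, swap_comm b a, mul_swap_eq_swap_mul (swap a b) b (π i),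
        swap_apply_right, swap_apply_of_ne_of_ne hqa hqb]
    rwa [this]

end Swaps

end FirstOccurrence

/-! ### Deleting a point, and cyclic shifts of intervals -/

namespace FirstOccurrence

open Equiv Equiv.Perm

/-- The permutation obtained from `s` by deleting the point `v` from the domain and its image
from the codomain, and renumbering. -/
def delPerm {l : ℕ} (s : Perm (Fin (l + 1))) (v : Fin (l + 1)) : Perm (Fin l) :=
  ((finSuccAboveEquiv v).trans (s.subtypeEquiv fun a => (s.injective.ne_iff (x := a)).symm)).trans
    (finSuccAboveEquiv (s v)).symm

theorem succAbove_delPerm {l : ℕ} (s : Perm (Fin (l + 1))) (v : Fin (l + 1)) (i : Fin l) :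
    (s v).succAbove (delPerm s v i) = s (v.succAbove i) := by
  have h : finSuccAboveEquiv (s v) (delPerm s v i) =
      ⟨s (v.succAbove i), s.injective.ne (Fin.succAbove_ne v i)⟩ := by
    simp only [delPerm, Equiv.trans_apply, Equiv.apply_symm_apply]
    rfl
  exact congrArg Subtype.val h

theorem val_succAbove {l : ℕ} (v : Fin (l + 1)) (i : Fin l) :
    (v.succAbove i : ℕ) = if (i : ℕ) < v then (i : ℕ) else i + 1 := by
  simp only [Fin.succAbove, Fin.lt_def, Fin.val_castSucc]
  split_ifs <;> simp

theorem val_delPerm {l : ℕ} (s : Perm (Fin (l + 1))) (v : Fin (l + 1)) (i : Fin l) :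
    (delPerm s v i : ℕ) = if (s (v.succAbove i) : ℕ) < s v then (s (v.succAbove i) : ℕ)
      else s (v.succAbove i) - 1 := by
  rw [← succAbove_delPerm, val_succAbove]
  split_ifs <;> omega

/-- Moving `v` and `s v` to the front by cycles of signs `(-1) ^ v` and `(-1) ^ s v` turns `s` into
`delPerm s v` preceded by a fixed point. -/
theorem sign_delPerm {l : ℕ} (s : Perm (Fin (l + 1))) (v : Fin (l + 1)) :
    sign (delPerm s v) = sign s * (-1) ^ ((v : ℕ) + s v) := by
  have h : s = ((s v).cycleRange)⁻¹ * decomposeFin.symm (0, delPerm s v) * v.cycleRange := by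
    ext x
    congr 1
    rw [Perm.mul_apply, Perm.mul_apply, Perm.eq_inv_iff_eq]
    by_cases hx : x = v
    · subst hx; simp
    · obtain ⟨i, rfl⟩ := Fin.exists_succAbove_eq hx
      rw [← succAbove_delPerm, Fin.cycleRange_succAbove, Fin.cycleRange_succAbove]
      simp
  have h2 : sign s = (-1) ^ (s v : ℕ) * sign (delPerm s v) * (-1) ^ (v : ℕ) := by
    conv_lhs => rw [h]
    simp [Perm.sign_mul, Fin.sign_cycleRange]
  rw [h2, pow_add]
  have e1 : ((-1 : ℤˣ) ^ (s v : ℕ)) * (-1) ^ (s v : ℕ) = 1 := by rw [← mul_pow]; simp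
  have e2 : ((-1 : ℤˣ) ^ (v : ℕ)) * (-1) ^ (v : ℕ) = 1 := by rw [← mul_pow]; simp
  generalize (-1 : ℤˣ) ^ (s v : ℕ) = x at *
  generalize (-1 : ℤˣ) ^ (v : ℕ) = y at *
  calc sign (delPerm s v) = sign (delPerm s v) * (x * x) * (y * y) := by rw [e1, e2]; simp
    _ = _ := by ac_rfl

/-- Deleting `u` amounts to deleting `u + 1` after exchanging the two values. -/
theorem delPerm_succ_swap {l : ℕ} (s : Perm (Fin (l + 1))) (u v : Fin (l + 1))
    (huv : (v : ℕ) = u + 1) : delPerm (s * swap u v) v = delPerm s u := by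
  ext i
  have hne : ∀ x y : Fin (l + 1), (x : ℕ) ≠ y → x ≠ y := fun x y h e => h (congrArg _ e)
  have : (s * swap u v) (v.succAbove i) = s (u.succAbove i) := by
    rw [Perm.mul_apply]
    congr 1
    have h1 := val_succAbove v i
    have h2 := val_succAbove u i
    by_cases h : (i : ℕ) = u
    · have e1 : v.succAbove i = u := Fin.ext (by rw [h1]; split_ifs <;> omega)
      rw [e1, swap_apply_left]
      exact Fin.ext (by rw [h2]; split_ifs <;> omega)
    · rw [swap_apply_of_ne_of_ne]
      · exact Fin.ext (by rw [h1, h2]; split_ifs <;> omega)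
      · exact hne _ _ (by rw [h1]; split_ifs <;> omega)
      · exact hne _ _ (by rw [h1]; split_ifs <;> omega)
  rw [val_delPerm, val_delPerm, this, Perm.mul_apply, swap_apply_right]

section Jump

variable {l : ℕ} {K : Subgroup (Perm (Fin l))}

/-- `K` contains the cyclic shift of the interval `[a, b)`. -/
def HasCycle (K : Subgroup (Perm (Fin l))) (a b : ℕ) : Prop :=
  ∃ π ∈ K, ∀ i : Fin l, (π i : ℕ) =
    if a ≤ (i : ℕ) ∧ (i : ℕ) + 1 < b then (i : ℕ) + 1 else if (i : ℕ) + 1 = b then a else i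

/-- `K` contains the transposition of `k - 1` and `k`. -/
def HasSwap (K : Subgroup (Perm (Fin l))) (k : ℕ) : Prop :=
  ∃ (i j : Fin l), (i : ℕ) + 1 = k ∧ (j : ℕ) = k ∧ swap i j ∈ K

/-- Both deletions remove the point `v`, but one removes the value `s u` and the other `s v`. Values
strictly between are therefore shifted by one, and `u` accounts for the jump from `s u - 1` to `s
v`. -/
theorem hasCycle_of_lt {s : Perm (Fin (l + 1))} {u v : Fin (l + 1)}
    (hlt : s v < s u) (h : delPerm (s * swap u v) v * (delPerm s v)⁻¹ ∈ K) :
    HasCycle K (s v) (s u) := by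
  refine ⟨_, h, fun i => ?_⟩
  obtain ⟨j, rfl⟩ := (delPerm s v).surjective i
  rw [Perm.mul_apply, Perm.inv_def, symm_apply_apply, val_delPerm, val_delPerm, Perm.mul_apply,
    Perm.mul_apply, swap_apply_right]
  rw [Fin.lt_def] at hlt
  by_cases hj : v.succAbove j = u
  · rw [hj, swap_apply_left]
    split_ifs <;> omega
  · rw [swap_apply_of_ne_of_ne hj (Fin.succAbove_ne v j)]
    have h1 : (s (v.succAbove j) : ℕ) ≠ s u := fun h => hj (s.injective (Fin.ext h))
    have h2 : (s (v.succAbove j) : ℕ) ≠ s v :=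
      fun h => Fin.succAbove_ne v j (s.injective (Fin.ext h))
    split_ifs <;> omega

theorem HasCycle.hasSwap {a : ℕ} (ha : a + 1 < l) (h : HasCycle K a (a + 2)) :
    HasSwap K (a + 1) := by
  obtain ⟨π, hπ, hv⟩ := h
  refine ⟨⟨a, by omega⟩, ⟨a + 1, ha⟩, rfl, rfl, ?_⟩
  convert hπ using 1
  ext i
  rw [hv]
  rw [swap_apply_def]
  simp only [Fin.ext_iff]
  split_ifs <;> simp_all <;> omega

/-- Conjugation by the cyclic shift carries an adjacent transposition along the interval. It may
even straddle an end: `k = a` and `k = b` are allowed. -/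
theorem HasSwap.of_hasCycle {a b k : ℕ} (h : HasCycle K a b) (hb : b ≤ l) (hk : HasSwap K k)
    (hak : a ≤ k) (hkb : k ≤ b) {k' : ℕ} (hak' : a < k') (hkb' : k' < b) : HasSwap K k' := by
  obtain ⟨π, hπ, hv⟩ := h
  have hup : ∀ k, a < k → k + 1 < b → HasSwap K k → HasSwap K (k + 1) := by
    rintro k h1 h2 ⟨i, j, hi, hj, hs⟩
    refine ⟨π i, π j, ?_, ?_, swap_mem_map hπ hs⟩
    · rw [hv]; split_ifs <;> omega
    · rw [hv]; split_ifs <;> omega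
  have hdown : ∀ k, a < k → k + 1 < b → HasSwap K (k + 1) → HasSwap K k := by
    rintro k h1 h2 ⟨i, j, hi, hj, hs⟩
    refine ⟨⟨k - 1, by omega⟩, ⟨k, by omega⟩, by simp only; omega, rfl, swap_mem_of_map hπ ?_⟩
    convert hs using 2
    · ext; rw [hv]; simp only; split_ifs <;> omega
    · ext; rw [hv]; simp only; split_ifs <;> omega
  have hspread : ∀ k, a < k → k < b → HasSwap K k → HasSwap K k' := by
    intro k h1 h2 hk
    rcases le_total k k' with h | h
    · induction k', h using Nat.le_induction with
      | base => exact hk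
      | succ m hm ih => exact hup m (by omega) hkb' (ih (by omega) (by omega))
    · induction k, h using Nat.le_induction with
      | base => exact hk
      | succ m hm ih => exact ih (by omega) (by omega) (hdown m (by omega) h2 hk)
  -- A transposition straddling an end has one point outside the interval, which the shift fixes.
  -- Composing it with a conjugate gives a transposition inside.
  rcases eq_or_lt_of_le hak with rfl | hak
  · obtain ⟨i, j, hi, hj, hs⟩ := hk
    refine hspread (a + 1) (by omega) (by omega) ⟨⟨a, by omega⟩, ⟨a + 1, by omega⟩, rfl, rfl, ?_⟩
    have h1 := swap_mem_map hπ hs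
    have e1 : π i = i := by ext; rw [hv]; split_ifs <;> omega
    have e2 : π j = ⟨a + 1, by omega⟩ := by ext; rw [hv]; simp only; split_ifs <;> omega
    have e3 : j = ⟨a, by omega⟩ := Fin.ext hj
    rw [e1, e2] at h1
    rw [← e3]
    exact swap_mem_trans (swap_mem_symm hs) h1
  rcases eq_or_lt_of_le hkb with rfl | hkb
  · obtain ⟨i, j, hi, hj, hs⟩ := hk
    refine hspread (k - 1) (by omega) (by omega)
      ⟨⟨k - 2, by omega⟩, ⟨k - 1, by omega⟩, by simp only; omega, rfl, ?_⟩
    have e1 : π ⟨k - 2, by omega⟩ = i := by ext; rw [hv]; simp only; split_ifs <;> omega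
    have e2 : π j = j := by ext; rw [hv]; split_ifs <;> omega
    have e3 : i = ⟨k - 1, by omega⟩ := Fin.ext (by simp only; omega)
    have h1 : swap ⟨k - 2, by omega⟩ j ∈ K := swap_mem_of_map hπ (by rw [e1, e2]; exact hs)
    rw [← e3]
    exact swap_mem_trans h1 (swap_mem_symm hs)
  · exact hspread k hak hkb hk

end Jump

end FirstOccurrence

/-! ### Combinatorics of interval cycles on the natural numbers -/

namespace FirstOccurrence

open Equiv Equiv.Perm

section Combinatorics

/-- The point `k` forms a block of its own: it is fixed, and so is the set of smaller points. -/
def IsSingleton (S : Perm ℕ) (k : ℕ) : Prop :=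
  S k = k ∧ ∀ x, x < k ↔ S x < k

theorem isSingleton_of_forall {S : Perm ℕ} {z k : ℕ} (hz : S z = k) (h : ∀ x, x < z ↔ S x < k) :
    IsSingleton S k := by
  have himg : (Finset.range z).image S = Finset.range k := by
    ext y
    simp only [Finset.mem_image, Finset.mem_range]
    constructor
    · rintro ⟨x, hx, rfl⟩; exact (h x).1 hx
    · intro hy
      exact ⟨S.symm y, (h _).2 (by simpa using hy), by simp⟩
  have hc := congrArg Finset.card himg
  rw [Finset.card_image_of_injective _ S.injective, Finset.card_range, Finset.card_range] at hc
  subst hc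
  exact ⟨hz, h⟩

variable {S : Perm ℕ} {l o : ℕ} {Good : ℕ → Prop} {Cyc : ℕ → ℕ → Prop}

theorem apply_le_of_le (hS : ∀ x, l < x → S x = x) {x : ℕ} (hx : x ≤ l) : S x ≤ l := by
  by_contra h
  have := S.injective (hS (S x) (by omega))
  omega

/-- `Cyc` and `Good` will be `HasCycle K` and `HasSwap K`. Without an inversion across `k`, all
values below `k` precede all values above it. The last value below `k` is then followed by one above
`k`, giving an adjacent pair across `k`, or by `k` itself, making `k` a singleton. -/
theorem exists_cycle_over (hS : ∀ x, l < x → S x = x) (hfix : ∀ x, x < o → S x = x)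
    (hB : ∀ u v, u < v → v ≤ l → S v < S u → Cyc (S v) (S u))
    (hA : ∀ u, o ≤ u → u + 1 ≤ l → S u < S (u + 1) → Cyc (S u) (S (u + 1)))
    {k : ℕ} (hok : o < k) (hkl : k < l) (hk : ¬ IsSingleton S k) :
    ∃ a b, a < k ∧ k < b ∧ b ≤ l ∧ Cyc a b := by
  by_cases h : ∃ u v, u < v ∧ S v < k ∧ k < S u
  · obtain ⟨u, v, huv, hv, hu⟩ := h
    have hvl : v ≤ l := by
      by_contra hvl
      have := hS v (by omega)
      omega
    exact ⟨S v, S u, hv, hu, apply_le_of_le hS (by omega), hB u v huv hvl (by omega)⟩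
  · have hno : ∀ u v, S v < k → k < S u → v < u := by
      intro u v hv hu
      by_contra hlt
      rcases Nat.lt_or_ge u v with h' | h'
      · exact h ⟨u, v, h', hv, hu⟩
      · have : u = v := by omega
        subst this; omega
    have ho : S (S.symm o) = o := S.apply_symm_apply o
    have hsl : S (S.symm l) = l := S.apply_symm_apply l
    have hoo : o ≤ S.symm o := by
      by_contra hlt
      have := hfix (S.symm o) (by omega)
      omega
    have hbd : ∀ y, S y < k → y ≤ l := by
      intro y hy
      by_contra hyl
      have := hS y (by omega)
      omega
    set x := Nat.findGreatest (fun y => S y < k) l with hx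
    have hxk : S x < k :=
      Nat.findGreatest_spec (P := fun y => S y < k) (hbd (S.symm o) (by omega)) (by omega)
    have hmax : ∀ y, S y < k → y ≤ x := fun y hy => Nat.le_findGreatest (hbd y hy) hy
    have hox : o ≤ x := hoo.trans (hmax _ (by omega))
    have hxl : x + 1 ≤ l := by
      have h1 := hno (S.symm l) x hxk (by omega)
      have h2 : S.symm l ≤ l := by
        by_contra hlt
        have := hS (S.symm l) (by omega)
        omega
      omega
    have hge : k ≤ S (x + 1) := by
      by_contra hlt
      have := hmax (x + 1) (by omega)
      omega
    rcases Nat.lt_or_ge k (S (x + 1)) with hgt | hle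
    · exact ⟨S x, S (x + 1), hxk, hgt, apply_le_of_le hS hxl, hA x hox hxl (by omega)⟩
    · refine absurd (isSingleton_of_forall (z := x + 1) (k := k) (by omega) fun y => ⟨?_, ?_⟩) hk
      · intro hy
        by_contra hyk
        rcases Nat.lt_or_ge k (S y) with h1 | h1
        · have := hno y x hxk h1
          omega
        · have : y = x + 1 := S.injective (by omega)
          omega
      · intro hy
        have := hmax y hy
        omega

/-- Let `p = S (k + 1) > k + 1`; the adjacent pair gives a cycle from `k` to `p`. It is a
transposition if `p = k + 2`. Otherwise the value `p - 2` occurs later, and this inversion gives a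
transposition that the cycle spreads to `k + 1`. -/
theorem good_of_isSingleton_pred (hS : ∀ x, l < x → S x = x)
    (hB : ∀ u v, u < v → v ≤ l → S v < S u → Cyc (S v) (S u))
    (hA : ∀ u, o ≤ u → u + 1 ≤ l → S u < S (u + 1) → Cyc (S u) (S (u + 1)))
    (hC : ∀ a, a + 2 ≤ l → Cyc a (a + 2) → Good (a + 1))
    (hD : ∀ a b k k', Cyc a b → b ≤ l → Good k → a ≤ k → k ≤ b → a < k' → k' < b → Good k')
    {k : ℕ} (hok : o ≤ k) (hkl : k + 1 < l) (hk : IsSingleton S k) (hk' : ¬ IsSingleton S (k + 1)) :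
    Good (k + 1) := by
  obtain ⟨hk1, hk2⟩ := hk
  have hpref : ∀ x, x < k + 1 ↔ S x < k + 1 := by
    intro x
    have h1 := hk2 x
    rcases eq_or_ne x k with rfl | hne
    · omega
    · have : S x ≠ k := fun h => hne (S.injective (h.trans hk1.symm))
      omega
  have hp1 := hpref (k + 1)
  have hp2 : S (k + 1) ≠ k + 1 := fun h => hk' ⟨h, hpref⟩
  have hple := apply_le_of_le hS (x := k + 1) (by omega)
  have hcyc := hA k hok (by omega) (by omega)
  rw [hk1] at hcyc
  generalize hp : S (k + 1) = p at *
  rcases Nat.lt_or_ge p (k + 3) with h | h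
  · have : p = k + 2 := by omega
    subst this
    exact hC k (by omega) hcyc
  · obtain ⟨v, hv⟩ := S.surjective (p - 2)
    have h1 := hpref v
    have h2 : v ≠ k + 1 := by rintro rfl; omega
    have h3 : v ≤ l := by
      by_contra hlt
      have := hS v (by omega)
      omega
    have h4 := hB (k + 1) v (by omega) h3 (by omega)
    rw [hp, hv] at h4
    have h5 := hC (p - 2) (by omega) (by rwa [show p - 2 + 2 = p by omega])
    exact hD k p _ _ hcyc hple h5 (by omega) (by omega) (by omega) (by omega)

/-- If `q = S (e + 1)` exceeded `e + 1`, the later value `e` would give a cycle from `e` to `q`, and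
some transposition inside it would spread to `e + 1`. -/
theorem apply_succ_of_not_good (hS : ∀ x, l < x → S x = x)
    (hB : ∀ u v, u < v → v ≤ l → S v < S u → Cyc (S v) (S u))
    (hA : ∀ u, o ≤ u → u + 1 ≤ l → S u < S (u + 1) → Cyc (S u) (S (u + 1)))
    (hC : ∀ a, a + 2 ≤ l → Cyc a (a + 2) → Good (a + 1))
    (hD : ∀ a b k k', Cyc a b → b ≤ l → Good k → a ≤ k → k ≤ b → a < k' → k' < b → Good k')
    {e : ℕ} (hoe : o ≤ e) (hel : e + 1 ≤ l) (hpref : ∀ x, x < e ↔ S x < e) (he : S e = e + 1)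
    (hng : e + 1 < l → ¬ Good (e + 1)) : S (e + 1) = e := by
  by_contra hne
  have h1 := hpref (e + 1)
  have h2 : S (e + 1) ≠ e + 1 := fun h => by
    have := S.injective (h.trans he.symm)
    omega
  have hqle := apply_le_of_le hS (x := e + 1) (by omega)
  have hq' := hA e hoe hel
  obtain ⟨y, hy⟩ := S.surjective e
  have hy1 := hpref y
  have hy2 : y ≠ e := by rintro rfl; omega
  have hy3 : y ≠ e + 1 := by rintro rfl; omega
  have hyl : y ≤ l := by
    by_contra hlt
    have := hS y (by omega)
    omega
  have hcyc := hB (e + 1) y (by omega) hyl (by omega)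
  rw [hy] at hcyc
  rw [he] at hq'
  generalize hq : S (e + 1) = q at *
  have hng' := hng (by omega)
  rcases Nat.lt_or_ge q (e + 4) with h | h
  -- For `q = e + 3` the value `q - 2 = e + 1` is taken at `e`, so it gives no inversion with `e +
  -- 1`. The ascending pair `e`, `e + 1` supplies the transposition instead.
  · rcases Nat.lt_or_ge q (e + 3) with h' | h'
    · have : q = e + 2 := by omega
      subst this
      exact hng' (hC e (by omega) hcyc)
    · have : q = e + 3 := by omega
      subst this
      exact hng' (hD e (e + 3) _ _ hcyc hqle (hC (e + 1) (by omega) (hq' (by omega)))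
        (by omega) (by omega) (by omega) (by omega))
  · obtain ⟨v, hv⟩ := S.surjective (q - 2)
    have h1 := hpref v
    have h2 : v ≠ e := by rintro rfl; omega
    have h2 : v ≠ e + 1 := by rintro rfl; omega
    have h3 : v ≤ l := by
      by_contra hlt
      have := hS v (by omega)
      omega
    have h4 := hB (e + 1) v (by omega) h3 (by omega)
    rw [hq, hv] at h4
    have h5 := hC (q - 2) (by omega) (by rwa [show q - 2 + 2 = q by omega])
    exact hng' (hD e q _ _ hcyc hqle h5 (by omega) (by omega) (by omega) (by omega))

/-- If the interval cycles belonging to the inversions and to the adjacent pairs of points do not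
make every point good or a singleton, then `S` exchanges the points of the consecutive pairs
`{o, o + 1}`, `{o + 2, o + 3}`, ... -/
theorem good_or_pairs (hS : ∀ x, l < x → S x = x) (hfix : ∀ x, x < o → S x = x)
    (hB : ∀ u v, u < v → v ≤ l → S v < S u → Cyc (S v) (S u))
    (hA : ∀ u, o ≤ u → u + 1 ≤ l → S u < S (u + 1) → Cyc (S u) (S (u + 1)))
    (hC : ∀ a, a + 2 ≤ l → Cyc a (a + 2) → Good (a + 1))
    (hD : ∀ a b k k', Cyc a b → b ≤ l → Good k → a ≤ k → k ≤ b → a < k' → k' < b → Good k') :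
    (∀ k, o < k → k < l → Good k ∨ IsSingleton S k) ∨
      ∀ i, o + 2 * i ≤ l → o + 2 * i + 1 ≤ l ∧ S (o + 2 * i) = o + 2 * i + 1 ∧
        S (o + 2 * i + 1) = o + 2 * i := by
  classical
  by_cases hall : ∀ k, o < k → k < l → Good k ∨ IsSingleton S k
  · exact Or.inl hall
  right
  push Not at hall
  have hmin := fun m => Nat.find_min (m := m) hall
  obtain ⟨hok, hkl, hkg, hks⟩ := Nat.find_spec hall
  generalize Nat.find hall = k at *
  have hprefo : ∀ x, x < o ↔ S x < o := by
    intro x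
    constructor
    · intro h; rw [hfix x h]; exact h
    · intro h
      have := S.injective (hfix (S x) h)
      omega
  -- `k` is the least point neither good nor a singleton. If `k - 1 > o`, then `k - 1` is good, and
  -- a cycle over `k` spreads this, or a singleton, and then `k` is good.
  have hko : k = o + 1 := by
    by_contra hne
    obtain ⟨a, b, ha, hb, hbl, hcyc⟩ := exists_cycle_over hS hfix hB hA hok hkl hks
    by_cases hg : Good (k - 1)
    · exact hkg (hD a b _ _ hcyc hbl hg (by omega) (by omega) ha hb)
    by_cases hs : IsSingleton S (k - 1)
    · refine hkg ?_
      have := good_of_isSingleton_pred hS hB hA hC hD (k := k - 1) (by omega) (by omega) hs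
        (by rwa [show k - 1 + 1 = k by omega])
      rwa [show k - 1 + 1 = k by omega] at this
    · exact hmin (k - 1) (by omega) ⟨by omega, by omega, hg, hs⟩
  subst hko
  have hoo : S o ≠ o := fun h =>
    hkg (good_of_isSingleton_pred hS hB hA hC hD le_rfl hkl ⟨h, hprefo⟩ hks)
  have hso : S o = o + 1 := by
    by_contra hne
    have h1 := hprefo o
    have hple := apply_le_of_le hS (x := o) (by omega)
    obtain ⟨y, hy⟩ := S.surjective o
    have hy1 := hprefo y
    have hy2 : y ≠ o := by rintro rfl; omega
    have hyl : y ≤ l := by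
      by_contra hlt
      have := hS y (by omega)
      omega
    have hcyc := hB o y (by omega) hyl (by omega)
    rw [hy] at hcyc
    obtain ⟨v, hv⟩ := S.surjective (S o - 2)
    have hv1 := hprefo v
    have hv2 : v ≠ o := by rintro rfl; omega
    have h3 : v ≤ l := by
      by_contra hlt
      have := hS v (by omega)
      omega
    have h4 := hB o v (by omega) h3 (by omega)
    rw [hv] at h4
    have h5 := hC (S o - 2) (by omega) (by rwa [show S o - 2 + 2 = S o by omega])
    exact hkg (hD o (S o) _ _ hcyc hple h5 (by omega) (by omega) (by omega) (by omega))
  have hstep : ∀ e, (∀ x, x < e ↔ S x < e) → S e = e + 1 → S (e + 1) = e →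
      ∀ x, x < e + 2 ↔ S x < e + 2 := by
    intro e hp h1 h2 x
    have h3 := hp x
    rcases eq_or_ne x e with rfl | hx
    · omega
    rcases eq_or_ne x (e + 1) with rfl | hx'
    · omega
    have h4 : S x ≠ e := fun h => hx' (S.injective (h.trans h2.symm))
    have h5 : S x ≠ e + 1 := fun h => hx (S.injective (h.trans h1.symm))
    omega
  intro i
  suffices H : o + 2 * i ≤ l → (∀ x, x < o + 2 * i ↔ S x < o + 2 * i) ∧ o + 2 * i + 1 ≤ l ∧
      S (o + 2 * i) = o + 2 * i + 1 ∧ S (o + 2 * i + 1) = o + 2 * i ∧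
      (o + 2 * i + 1 < l → ¬ Good (o + 2 * i + 1)) from fun h => ⟨(H h).2.1, (H h).2.2.1,
        (H h).2.2.2.1⟩
  induction i with
  | zero =>
    intro _
    exact ⟨hprefo, by omega, hso, apply_succ_of_not_good hS hB hA hC hD le_rfl (by omega) hprefo hso
      fun _ => hkg, fun _ => hkg⟩
  | succ i ih =>
    intro hle
    obtain ⟨hp, -, h1, h2, hng⟩ := ih (by omega)
    have hpe := hstep _ hp h1 h2
    have hng := hng (by omega)
    have he : o + 2 * (i + 1) = o + 2 * i + 2 := by ring
    rw [he] at hle ⊢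
    generalize hE : o + 2 * i = E at *
    have hp1 := hpe (E + 2)
    have hpl := apply_le_of_le hS hle
    have hcyc : Cyc (S (E + 1)) (S (E + 2)) := hA (E + 1) (by omega) (by omega)
      (show S (E + 1) < S (E + 2) by omega)
    rw [h2] at hcyc
    have hpE : S (E + 2) = E + 3 := by
      rcases Nat.lt_or_ge (S (E + 2)) (E + 4) with h | h
      · by_contra hne
        rw [show S (E + 2) = E + 2 by omega] at hcyc
        exact hng (hC E (by omega) hcyc)
      · exfalso
        obtain ⟨v, hv⟩ := S.surjective (S (E + 2) - 2)
        have hv1 := hpe v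
        have hv2 : v ≠ E + 2 := by rintro rfl; omega
        have h3 : v ≤ l := by
          by_contra hlt
          have := hS v (by omega)
          omega
        have h4 := hB (E + 2) v (by omega) h3 (by omega)
        rw [hv] at h4
        have h5 := hC (S (E + 2) - 2) (by omega) (by rwa [show S (E + 2) - 2 + 2 = S (E + 2) by omega])
        exact hng (hD E (S (E + 2)) _ _ hcyc hpl h5 (by omega) (by omega) (by omega) (by omega))
    have hng' : E + 2 + 1 < l → ¬ Good (E + 2 + 1) := by
      intro _ hg
      exact hng (hD E (S (E + 2)) _ _ hcyc hpl hg (by omega) (by omega) (by omega) (by omega))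
    exact ⟨hpe, by omega, hpE,
      apply_succ_of_not_good hS hB hA hC hD (by omega) (by omega) hpe hpE hng', hng'⟩

end Combinatorics

end FirstOccurrence

/-! ### Deletions in one coset: the pairs alternative -/

namespace FirstOccurrence

open Equiv Equiv.Perm

/-- The extension of a permutation of `Fin n` to the natural numbers. -/
def natPerm {n : ℕ} (s : Perm (Fin n)) : Perm ℕ :=
  s.extendDomain Fin.equivSubtype

theorem natPerm_val {n : ℕ} (s : Perm (Fin n)) (x : Fin n) : natPerm s x = s x := by
  have := s.extendDomain_apply_image Fin.equivSubtype x
  exact this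

theorem natPerm_of_lt {n : ℕ} (s : Perm (Fin n)) {x : ℕ} (hx : x < n) :
    natPerm s x = s ⟨x, hx⟩ :=
  natPerm_val s ⟨x, hx⟩

theorem natPerm_of_ge {n : ℕ} (s : Perm (Fin n)) {x : ℕ} (hx : n ≤ x) : natPerm s x = x :=
  s.extendDomain_apply_not_subtype Fin.equivSubtype (by omega)

/-- `s` exchanges the points of the consecutive pairs `{o, o + 1}`, `{o + 2, o + 3}`, ... and
fixes the points below `o`. -/
def IsPairs {n : ℕ} (s : Perm (Fin n)) (o : ℕ) : Prop :=
  ∀ x : Fin n, (s x : ℕ) = if (x : ℕ) < o then (x : ℕ)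
    else if ((x : ℕ) - o) % 2 = 0 then (x : ℕ) + 1 else x - 1

/-- The only inversions are the `h` exchanged pairs. -/
theorem IsPairs.sign_eq {n : ℕ} {s : Perm (Fin n)} {o h : ℕ} (hs : IsPairs s o)
    (hn : n = o + 2 * h) : sign s = (-1) ^ h := by
  have hinner : ∀ j : Fin n, (∏ i < j, if s i < s j then (1 : ℤˣ) else -1) =
      if o ≤ (j : ℕ) ∧ ((j : ℕ) - o) % 2 = 1 then -1 else 1 := by
    intro j
    have hj := hs j
    split_ifs with hc
    · rw [Finset.prod_eq_single (⟨j - 1, by omega⟩ : Fin n)]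
      · have h1 := hs ⟨j - 1, by omega⟩
        rw [if_neg]
        rw [Fin.lt_def, h1, hj]
        simp only
        split_ifs <;> omega
      · intro i hi hne
        have h1 := hs i
        have h2 : (i : ℕ) ≠ j - 1 := fun h => hne (Fin.ext h)
        have h3 : (i : ℕ) < j := by simpa using hi
        rw [if_pos]
        rw [Fin.lt_def, h1, hj]
        split_ifs <;> omega
      · intro h
        refine absurd ?_ h
        rw [Finset.mem_Iio, Fin.lt_def]
        simp only
        omega
    · refine Finset.prod_eq_one fun i hi => ?_
      have h1 := hs i
      have h3 : (i : ℕ) < j := by simpa using hi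
      rw [if_pos]
      rw [Fin.lt_def, h1, hj]
      split_ifs <;> omega
  rw [sign_eq_prod_prod_Iio, Finset.prod_congr rfl fun j _ => hinner j,
    Fin.prod_univ_eq_prod_range (fun j => if o ≤ j ∧ (j - o) % 2 = 1 then (-1 : ℤˣ) else 1) n, hn]
  clear hinner hs s hn
  induction h with
  | zero =>
    refine Finset.prod_eq_one fun i hi => ?_
    have : i < o := by simpa using hi
    rw [if_neg]; omega
  | succ h ih =>
    rw [show o + 2 * (h + 1) = o + 2 * h + 1 + 1 by ring, Finset.prod_range_succ,
      Finset.prod_range_succ, ih, if_neg (by omega), if_pos (by omega), pow_succ]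
    simp

section Coset

variable {l : ℕ} {K : Subgroup (Perm (Fin l))}

theorem mul_inv_mem_of_coset {κ ρ ρ' : Perm (Fin l)} (h : ρ * κ⁻¹ ∈ K) (h' : ρ' * κ⁻¹ ∈ K) :
    ρ * ρ'⁻¹ ∈ K := by
  have := K.mul_mem h (K.inv_mem h')
  simpa [mul_assoc] using this

theorem swap_mem_of_hasSwap {a b : ℕ} (hab : a ≤ b) (hb : b < l)
    (h : ∀ k, a < k → k ≤ b → HasSwap K k) :
    swap (⟨a, by omega⟩ : Fin l) ⟨b, hb⟩ ∈ K := by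
  induction b, hab using Nat.le_induction with
  | base => exact swap_self_mem _
  | succ m hm ih =>
    obtain ⟨i, j, hi, hj, hs⟩ := h (m + 1) (by omega) le_rfl
    have e1 : i = ⟨m, by omega⟩ := Fin.ext (by simp only; omega)
    have e2 : j = ⟨m + 1, hb⟩ := Fin.ext hj
    rw [e2, e1] at hs
    exact swap_mem_trans (ih (by omega) fun k h1 h2 => h k h1 (by omega)) hs

variable {s : Perm (Fin (l + 1))} {κ : Perm (Fin l)} {o : ℕ}

theorem hasCycle_of_inversion (hfix : ∀ x : Fin (l + 1), (x : ℕ) < o → s x = x)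
    (hdel : ∀ v : Fin (l + 1), o ≤ v → delPerm s v * κ⁻¹ ∈ K)
    (hinv : ∀ u v, u < v → s v < s u → delPerm (s * swap u v) v * κ⁻¹ ∈ K)
    {u v : Fin (l + 1)} (huv : u < v) (h : s v < s u) : HasCycle K (s v) (s u) := by
  have hv : o ≤ (v : ℕ) := by
    by_contra hlt
    rw [hfix v (by omega), hfix u (by rw [Fin.lt_def] at huv; omega)] at h
    exact absurd h (not_lt.2 huv.le)
  exact hasCycle_of_lt h (mul_inv_mem_of_coset (hinv u v huv h) (hdel v hv))

/-- By `delPerm_succ_swap`, deleting `u` is deleting `u + 1` after an exchange, so two adjacent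
deletions compare as in `hasCycle_of_lt`. -/
theorem hasCycle_of_adjacent
    (hdel : ∀ v : Fin (l + 1), o ≤ v → delPerm s v * κ⁻¹ ∈ K)
    {u v : Fin (l + 1)} (hu : o ≤ (u : ℕ)) (huv : (v : ℕ) = u + 1) (h : s u < s v) :
    HasCycle K (s u) (s v) := by
  have h1 := mul_inv_mem_of_coset (hdel v (by omega)) (hdel u hu)
  rw [← delPerm_succ_swap s u v huv] at h1
  have h2 := hasCycle_of_lt (K := K) (s := s * swap u v) (u := u) (v := v) (by simpa using h)
    (by simpa [mul_assoc] using h1)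
  simpa using h2

/-- If all deletions and all inversion merges of `s` lie in one coset of `K`, then this coset is
`K` itself, unless `s` consists of exchanged consecutive pairs. -/
theorem mem_or_isPairs (ho : o ≤ l) (hfix : ∀ x : Fin (l + 1), (x : ℕ) < o → s x = x)
    (hdel : ∀ v : Fin (l + 1), o ≤ v → delPerm s v * κ⁻¹ ∈ K)
    (hinv : ∀ u v, u < v → s v < s u → delPerm (s * swap u v) v * κ⁻¹ ∈ K) :
    κ ∈ K ∨ IsPairs s o := by
  have hS : ∀ x, l < x → natPerm s x = x := fun x hx => natPerm_of_ge s hx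
  have hfix' : ∀ x, x < o → natPerm s x = x := by
    intro x hx
    rw [natPerm_of_lt s (show x < l + 1 by omega), hfix _ hx]
  have hval := natPerm_val s
  have hB : ∀ u v, u < v → v ≤ l → natPerm s v < natPerm s u →
      HasCycle K (natPerm s v) (natPerm s u) := by
    intro u v huv hv h
    rw [natPerm_of_lt s (show u < l + 1 by omega), natPerm_of_lt s (show v < l + 1 by omega)] at h ⊢
    exact hasCycle_of_inversion hfix hdel hinv huv h
  have hA : ∀ u, o ≤ u → u + 1 ≤ l → natPerm s u < natPerm s (u + 1) →
      HasCycle K (natPerm s u) (natPerm s (u + 1)) := by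
    intro u hu hul h
    rw [natPerm_of_lt s (show u < l + 1 by omega),
      natPerm_of_lt s (show u + 1 < l + 1 by omega)] at h ⊢
    exact hasCycle_of_adjacent hdel hu rfl h
  rcases good_or_pairs (Good := HasSwap K) hS hfix' hB hA (fun a ha h => h.hasSwap (by omega))
    (fun a b k k' h hb hk h1 h2 h3 h4 => hk.of_hasCycle h hb h1 h2 h3 h4) with hgood | hpairs
  · left
    -- A singleton `k` separates the values on its two sides, so the deletion of the last point
    -- carries no `i` across it. Every `k` between `i` and its image is thus good.
    have hρ : delPerm s (Fin.last l) ∈ K := by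
      refine mem_of_forall_swap_mem K _ fun i => ?_
      have h1 := val_delPerm s (Fin.last l) i
      have h2 : (Fin.last l).succAbove i = i.castSucc := Fin.succAbove_last_apply i
      rw [h2] at h1
      have h3 : natPerm s i = s i.castSucc := hval i.castSucc
      have h4 : natPerm s l = s (Fin.last l) := hval (Fin.last l)
      rw [← h3, ← h4] at h1
      have hne : natPerm s i ≠ natPerm s l := fun h => by
        have := (natPerm s).injective h
        omega
      have hol : o ≤ natPerm s l := by
        by_contra hlt
        have := (natPerm s).injective (hfix' (natPerm s l) (by omega))
        omega
      have hoi : o ≤ (i : ℕ) → o ≤ natPerm s i := by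
        intro hi
        by_contra hlt
        have := (natPerm s).injective (hfix' (natPerm s i) (by omega))
        omega
      have hio : (i : ℕ) < o → natPerm s i = i := fun hi => hfix' i hi
      rcases le_total (i : ℕ) (delPerm s (Fin.last l) i) with hle | hle
      · refine swap_mem_of_hasSwap hle (delPerm s (Fin.last l) i).2 fun k hk1 hk2 => ?_
        have hkl : k < l := lt_of_le_of_lt hk2 (delPerm s (Fin.last l) i).2
        refine (hgood k ?_ hkl).resolve_right fun hsing => ?_
        · split_ifs at h1 <;> omega
        · have := hsing.2 i
          split_ifs at h1 <;> omega
      · refine swap_mem_symm (swap_mem_of_hasSwap hle i.2 fun k hk1 hk2 => ?_)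
        have hkl : k < l := lt_of_le_of_lt hk2 i.2
        refine (hgood k ?_ hkl).resolve_right fun hsing => ?_
        · split_ifs at h1 <;> omega
        · have e1 := hsing.2 i
          have e2 := hsing.2 l
          split_ifs at h1 with h5
          · omega
          · omega
    have := K.mul_mem (K.inv_mem (hdel (Fin.last l) ho)) hρ
    simpa using this
  · right
    intro x
    rw [← hval x]
    split_ifs with h1 h2
    · exact hfix' x h1
    · have := (hpairs (((x : ℕ) - o) / 2) (by omega)).2.1
      rw [show o + 2 * (((x : ℕ) - o) / 2) = x by omega] at this
      exact this
    · have := (hpairs (((x : ℕ) - o) / 2) (by omega)).2.2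
      rw [show o + 2 * (((x : ℕ) - o) / 2) + 1 = x by omega] at this
      omega

/-- The ends of adjacent pairs give three-cycles on `{o, o + 1, o + 2}`, `{o + 2, o + 3, o + 4}`,
and so on. Consecutive ones overlap in a point, so `K` contains all even permutations of the points
from `o` on. Since `h` is odd, the deletion of the last point is one of them. -/
theorem mem_of_isPairs (h : ℕ) (hl : l + 1 = o + 2 * h) (hodd : h % 2 = 1) (hs : IsPairs s o)
    (hdel : ∀ v : Fin (l + 1), o ≤ v → delPerm s v * κ⁻¹ ∈ K) : κ ∈ K := by
  have hρ : delPerm s (Fin.last l) ∈ K := by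
    have hlast := hs (Fin.last l)
    rw [Fin.val_last, if_neg (by omega), if_neg (by omega)] at hlast
    have hmove : ∀ x : Fin l, delPerm s (Fin.last l) x ≠ x → o ≤ (x : ℕ) ∧ (x : ℕ) + 1 < l := by
      intro x hx
      have h1 := val_delPerm s (Fin.last l) x
      rw [Fin.succAbove_last_apply, hlast, hs] at h1
      have h2 : ((delPerm s (Fin.last l) x : Fin l) : ℕ) ≠ x := fun h => hx (Fin.ext h)
      have h3 := x.2
      simp only [Fin.val_castSucc] at h1
      split_ifs at h1 <;> omega
    by_cases h1 : h = 1
    · convert K.one_mem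
      ext x
      by_contra hne
      have := hmove x fun h => hne (by rw [h]; rfl)
      omega
    · have hab : (⟨o, by omega⟩ : Fin l) ≠ ⟨o + 1, by omega⟩ := by simp
      refine mem_of_sign_eq_one (a := ⟨o, by omega⟩) (b := ⟨o + 1, by omega⟩) hab ?_ ?_
      · rw [sign_delPerm, hs.sign_eq hl, hlast, Fin.val_last, Odd.neg_one_pow (by
          rw [Nat.odd_iff]; omega), Odd.neg_one_pow (by rw [Nat.odd_iff]; omega)]
        simp
      · have hcyc : ∀ i, o + 2 * i + 3 ≤ l → HasCycle K (o + 2 * i) (o + 2 * i + 3) := by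
          intro i hi
          have h2 := hs ⟨o + 2 * i + 1, by omega⟩
          have h3 := hs ⟨o + 2 * i + 2, by omega⟩
          simp only at h2 h3
          rw [if_neg (by omega), if_neg (by omega)] at h2
          rw [if_neg (by omega), if_pos (by omega)] at h3
          have := hasCycle_of_adjacent hdel (u := ⟨o + 2 * i + 1, by omega⟩)
            (v := ⟨o + 2 * i + 2, by omega⟩) (by simp only; omega) rfl
            (by rw [Fin.lt_def, h2, h3]; omega)
          rw [h2, h3] at this
          exact this
        have hall : ∀ i, o + 2 * i + 3 ≤ l → ∀ x : Fin l, o ≤ (x : ℕ) → (x : ℕ) ≤ o + 2 * i + 2 →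
            x ∈ threeSet K ⟨o, by omega⟩ ⟨o + 1, by omega⟩ := by
          intro i
          induction i with
          | zero =>
            intro hi x hx1 hx2
            obtain ⟨π, hπ, hv⟩ := hcyc 0 hi
            rcases Nat.lt_or_ge x (o + 2) with h2 | h2
            · rcases Nat.lt_or_ge x (o + 1) with h3 | h3
              · exact Or.inl (Fin.ext (by simp only; omega))
              · exact Or.inr (Or.inl (Fin.ext (by simp only; omega)))
            · refine Or.inr (Or.inr ?_)
              convert hπ using 1
              ext y
              rw [hv, Perm.mul_apply]
              simp only [swap_apply_def, Fin.ext_iff]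
              split_ifs <;> simp_all <;> omega
          | succ i ih =>
            intro hi x hx1 hx2
            obtain ⟨π, hπ, hv⟩ := hcyc (i + 1) hi
            have ih := ih (by omega)
            have ha := left_mem_threeSet (K := K) (⟨o, by omega⟩ : Fin l) ⟨o + 1, by omega⟩
            have hb := right_mem_threeSet (K := K) (⟨o, by omega⟩ : Fin l) ⟨o + 1, by omega⟩
            have ea : π ⟨o, by omega⟩ = ⟨o, by omega⟩ := by
              ext; rw [hv]; simp only; split_ifs <;> omega
            have eb : π ⟨o + 1, by omega⟩ = ⟨o + 1, by omega⟩ := by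
              ext; rw [hv]; simp only; split_ifs <;> omega
            have step : ∀ y : Fin l, o + 2 ≤ (y : ℕ) →
                y ∈ threeSet K (⟨o, by omega⟩ : Fin l) ⟨o + 1, by omega⟩ →
                π y ∈ threeSet K (⟨o, by omega⟩ : Fin l) ⟨o + 1, by omega⟩ := by
              intro y hy hyT
              refine map_mem_threeSet hab hπ (j := ⟨o, by omega⟩) (k := ⟨o + 1, by omega⟩) ?_ hab
                hyT ha hb (by rw [ea]; exact ha) (by rw [eb]; exact hb)
              intro e
              rw [e] at hy
              simp at hy
            have s1 := step ⟨o + 2 * i + 2, by omega⟩ (by simp only; omega)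
              (ih _ (by simp only; omega) le_rfl)
            have e1 : π ⟨o + 2 * i + 2, by omega⟩ = ⟨o + 2 * i + 3, by omega⟩ := by
              ext; rw [hv]; simp only; split_ifs <;> omega
            have e2 : π ⟨o + 2 * i + 3, by omega⟩ = ⟨o + 2 * i + 4, by omega⟩ := by
              ext; rw [hv]; simp only; split_ifs <;> omega
            rw [e1] at s1
            have s2 := step _ (by simp only; omega) s1
            rw [e2] at s2
            rcases Nat.lt_or_ge (x : ℕ) (o + 2 * i + 3) with h3 | h3
            · exact ih x hx1 (by omega)
            · rcases Nat.lt_or_ge (x : ℕ) (o + 2 * i + 4) with h4 | h4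
              · rw [show x = ⟨o + 2 * i + 3, by omega⟩ from Fin.ext (by simp only; omega)]
                exact s1
              · rw [show x = ⟨o + 2 * i + 4, by omega⟩ from Fin.ext (by simp only; omega)]
                exact s2
        intro x hx
        have := hmove x hx
        exact hall (h - 2) (by omega) x this.1 (by omega)
  have := K.mul_mem (K.inv_mem (hdel (Fin.last l) (by rw [Fin.val_last]; omega))) hρ
  simpa using this

end Coset

end FirstOccurrence

/-! ### Merges, commutators and a parity count -/

namespace FirstOccurrence

open Equiv Equiv.Perm

/-- The permutation relating the two orders of first occurrence when the points `u < v` carry the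
same label and all other labels are distinct. -/
def mergePerm {l : ℕ} (s : Perm (Fin (l + 1))) (u v : Fin (l + 1)) : Perm (Fin l) :=
  delPerm (if s u < s v then s else s * swap u v) v

theorem mergePerm_of_lt {l : ℕ} {s : Perm (Fin (l + 1))} {u v : Fin (l + 1)} (h : s u < s v) :
    mergePerm s u v = delPerm s v := by
  rw [mergePerm, if_pos h]

theorem mergePerm_of_gt {l : ℕ} {s : Perm (Fin (l + 1))} {u v : Fin (l + 1)} (h : s v < s u) :
    mergePerm s u v = delPerm (s * swap u v) v := by
  rw [mergePerm, if_neg (not_lt.2 h.le)]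

section ThreeCycle

theorem val_cycleRange {l : ℕ} (b i : Fin l) : (b.cycleRange i : ℕ) =
    if (i : ℕ) < b then (i : ℕ) + 1 else if (i : ℕ) = b then 0 else i := by
  split_ifs with h1 h2
  · exact Fin.coe_cycleRange_of_lt h1
  · have : i = b := Fin.ext h2
    subst this
    have : NeZero l := ⟨by have := i.2; omega⟩
    rw [Fin.cycleRange_self]
    rfl
  · rw [Fin.cycleRange_of_gt (by rw [Fin.lt_def]; omega)]

theorem val_cycleRange_inv {l : ℕ} (b i : Fin l) : ((b.cycleRange⁻¹ : Perm (Fin l)) i : ℕ) =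
    if (i : ℕ) = 0 then (b : ℕ) else if (i : ℕ) ≤ b then (i : ℕ) - 1 else i := by
  obtain ⟨j, rfl⟩ := b.cycleRange.surjective i
  have h := val_cycleRange b j
  rw [Perm.inv_def, symm_apply_apply]
  split_ifs at h ⊢ <;> omega

/-- A commutator of cyclic shifts of intervals sharing an end point is a three-cycle. -/
theorem cycleRange_commutator {l : ℕ} {b₁ b₂ b₃ : Fin l} (h₁ : b₁ < b₂) (h₂ : b₂ < b₃) :
    (b₁.cycleRange⁻¹ * b₂.cycleRange) * (b₃.cycleRange⁻¹ * b₁.cycleRange) *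
      (b₂.cycleRange⁻¹ * b₃.cycleRange) = swap b₂ b₁ * swap b₁ b₃ := by
  rw [Fin.lt_def] at h₁ h₂
  have e1 : ∀ i, ((b₁.cycleRange⁻¹ * b₂.cycleRange) i : ℕ) =
      if (i : ℕ) = b₂ then (b₁ : ℕ) else if (b₁ : ℕ) ≤ i ∧ (i : ℕ) < b₂ then (i : ℕ) + 1 else i := by
    intro i
    have h := val_cycleRange b₂ i
    rw [Perm.mul_apply, val_cycleRange_inv]
    split_ifs at h ⊢ <;> omega
  have e2 : ∀ i, ((b₂.cycleRange⁻¹ * b₃.cycleRange) i : ℕ) =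
      if (i : ℕ) = b₃ then (b₂ : ℕ) else if (b₂ : ℕ) ≤ i ∧ (i : ℕ) < b₃ then (i : ℕ) + 1 else i := by
    intro i
    have h := val_cycleRange b₃ i
    rw [Perm.mul_apply, val_cycleRange_inv]
    split_ifs at h ⊢ <;> omega
  have e3 : ∀ i, ((b₃.cycleRange⁻¹ * b₁.cycleRange) i : ℕ) =
      if (i : ℕ) = b₁ then (b₃ : ℕ) else if (b₁ : ℕ) < i ∧ (i : ℕ) ≤ b₃ then (i : ℕ) - 1 else i := by
    intro i
    have h := val_cycleRange b₁ i
    rw [Perm.mul_apply, val_cycleRange_inv]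
    split_ifs at h ⊢ <;> omega
  ext i
  rw [Perm.mul_apply, Perm.mul_apply, Perm.mul_apply (swap b₂ b₁)]
  have h2 := e2 i
  generalize (b₂.cycleRange⁻¹ * b₃.cycleRange) i = j at h2 ⊢
  have h3 := e3 j
  generalize (b₃.cycleRange⁻¹ * b₁.cycleRange) j = k at h3 ⊢
  rw [e1]
  have h4 : (swap b₂ b₁ (swap b₁ b₃ i) : ℕ) = if (i : ℕ) = b₁ then (b₃ : ℕ)
      else if (i : ℕ) = b₃ then (b₂ : ℕ) else if (i : ℕ) = b₂ then (b₁ : ℕ) else i := by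
    simp only [swap_apply_def, Fin.ext_iff]
    split_ifs <;> simp_all <;> omega
  rw [h4]
  clear h4 e1 e2 e3
  split_ifs at h2 <;> split_ifs at h3 ⊢ <;> omega

variable {X : Type*} [DecidableEq X] {K : Subgroup (Perm X)}

theorem three_rotate {x y z : X} (hxz : x ≠ z) (hxy : x ≠ y)
    (h : swap x y * swap y z ∈ K) : swap y z * swap z x ∈ K := by
  rwa [mul_swap_eq_swap_mul, swap_apply_right, swap_apply_of_ne_of_ne hxy hxz, swap_comm y x]

theorem three_reverse {x y z : X} (hxz : x ≠ z) (hyz : y ≠ z)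
    (h : swap x y * swap y z ∈ K) : swap y x * swap x z ∈ K := by
  have := K.inv_mem h
  have e : swap y x * swap x z = (swap x y * swap y z)⁻¹ := by
    rw [mul_inv_rev, swap_inv, swap_inv, swap_comm y x, mul_swap_eq_swap_mul, swap_apply_left,
      swap_apply_of_ne_of_ne (Ne.symm hxz) (Ne.symm hyz)]
  rwa [e]

end ThreeCycle

/-- The `k` values below `k` come first, so by counting they occupy exactly the first `k` positions.
-/
theorem lt_iff_of_separated {S : Perm ℕ} {k : ℕ} (h : ∀ x y, S x < k → k ≤ S y → x < y) (x : ℕ) :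
    x < k ↔ S x < k := by
  constructor
  · intro hx
    by_contra hS
    have hsub : (Finset.range k).image S.symm ⊆ Finset.range x := by
      intro y hy
      simp only [Finset.mem_image, Finset.mem_range] at hy ⊢
      obtain ⟨t, ht, rfl⟩ := hy
      exact h _ _ (by simpa using ht) (by omega)
    have := Finset.card_le_card hsub
    rw [Finset.card_image_of_injective _ S.symm.injective, Finset.card_range,
      Finset.card_range] at this
    omega
  · intro hS
    by_contra hx
    have hsub : (Finset.range (x + 1)).image S ⊆ Finset.range k := by
      intro t ht
      simp only [Finset.mem_image, Finset.mem_range] at ht ⊢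
      obtain ⟨y, hy, rfl⟩ := ht
      by_contra hlt
      have := h x y hS (by omega)
      omega
    have := Finset.card_le_card hsub
    rw [Finset.card_image_of_injective _ S.injective, Finset.card_range,
      Finset.card_range] at this
    omega

/-- Without such an inversion, the value `k` comes either after all smaller values, making `[0, k)`
invariant, or before all larger ones, making `[0, k + 1)` invariant. -/
theorem exists_inversion_over {S : Perm ℕ} {k : ℕ} (h1 : ¬ ∀ x, x < k ↔ S x < k)
    (h2 : ¬ ∀ x, x < k + 1 ↔ S x < k + 1) : ∃ u v, u < v ∧ S v < k ∧ k < S u := by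
  by_contra hno
  have hno' : ∀ u v, S v < k → k < S u → v < u := by
    intro u v hv hu
    by_contra hlt
    rcases Nat.lt_or_ge u v with h' | h'
    · exact hno ⟨u, v, h', hv, hu⟩
    · have : u = v := by omega
      subst this; omega
  obtain ⟨z, hz⟩ := S.surjective k
  by_cases hall : ∀ x, S x < k → x < z
  · refine h1 (lt_iff_of_separated fun x y hx hy => ?_)
    rcases eq_or_lt_of_le hy with hy | hy
    · rw [show y = z from S.injective (hy.symm.trans hz.symm)]
      exact hall x hx
    · exact hno' y x hx hy
  · push Not at hall
    obtain ⟨x₀, hx₀, hzx⟩ := hall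
    refine h2 (lt_iff_of_separated fun x y hx hy => ?_)
    have hy0 := hno' y x₀ hx₀ (by omega)
    rcases eq_or_lt_of_le (Nat.lt_succ_iff.1 hx) with hx | hx
    · rw [show x = z from S.injective (hx.trans hz.symm)]
      omega
    · exact hno' y x hx (by omega)

/-- For a permutation of an initial segment mapping `0` to some `P ≥ 2`, the parities occurring
below do not all agree. -/
theorem parity_count {S : Perm ℕ} {e P : ℕ} (hpref : ∀ x, x < e ↔ S x < e) (h0 : S 0 = P)
    (hP : 2 ≤ P) (hPe : P < e) (ε : ℤ) (hε : ε = 1 ∨ ε = -1)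
    (hlo : ∀ x, x < e → S x < P → (-1 : ℤ) ^ x = -ε * (-1) ^ P)
    (hhi : ∀ x, x < e → P < S x → (-1 : ℤ) ^ x = ε * (-1) ^ (S x)) : False := by
  obtain ⟨r, rfl⟩ := Nat.exists_eq_add_of_lt hPe
  -- The alternating sum over positions is `0` or `1`. Summed by values, those below `P` contribute
  -- `±P`, the value `P` at position `0` contributes `1`, and those above `P` contribute `0` or
  -- `±1`. These agree for no `P ≥ 2`.
  have h1 : ∑ x ∈ Finset.range (P + r + 1), (-1 : ℤ) ^ x =
      ∑ t ∈ Finset.range (P + r + 1), (-1 : ℤ) ^ (S.symm t) := by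
    refine Finset.sum_bij (fun x _ => S x) ?_ ?_ ?_ ?_
    · intro x hx; simpa using (hpref x).1 (by simpa using hx)
    · intro x _ y _ h; exact S.injective h
    · intro t ht
      exact ⟨S.symm t, by simpa using (hpref (S.symm t)).2 (by simpa using ht), by simp⟩
    · intro x _; simp
  have hsymm : ∀ t, t < P + r + 1 → S.symm t < P + r + 1 :=
    fun t ht => (hpref (S.symm t)).2 (by simpa using ht)
  have hA : ∑ x ∈ Finset.range P, (-1 : ℤ) ^ (S.symm x) = P * (-ε * (-1) ^ P) := by
    rw [Finset.sum_congr rfl fun t ht => hlo (S.symm t)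
      (hsymm t (by have := Finset.mem_range.1 ht; omega)) (by simpa using ht)]
    simp
  have hB : ∑ x ∈ Finset.range r, (-1 : ℤ) ^ (S.symm (P + 1 + x)) =
      ε * ((-1) ^ (P + 1) * ∑ x ∈ Finset.range r, (-1 : ℤ) ^ x) := by
    rw [Finset.mul_sum, Finset.mul_sum]
    refine Finset.sum_congr rfl fun t ht => ?_
    have ht := Finset.mem_range.1 ht
    rw [hhi (S.symm (P + 1 + t)) (hsymm _ (by omega)) (by simp; omega), apply_symm_apply, pow_add]
  have hz : S.symm P = 0 := by rw [← h0, symm_apply_apply]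
  rw [show P + r + 1 = (P + 1) + r by ring, Finset.sum_range_add _ (P + 1) r,
    Finset.sum_range_add _ (P + 1) r,
    Finset.sum_range_succ _ P, Finset.sum_range_succ _ P, hA, hB, hz] at h1
  simp only [pow_add, ← Finset.mul_sum, neg_one_geom_sum] at h1
  rcases Nat.even_or_odd P with hp | hp <;> rcases Nat.even_or_odd r with hr | hr <;>
    rcases hε with rfl | rfl <;>
    simp only [hp, hr, Even.neg_one_pow, Odd.neg_one_pow, if_true, if_false,
      Nat.not_even_iff_odd.2] at h1 <;> norm_num at h1 <;> omega

end FirstOccurrence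

/-! ### Three-cycles from merging with the first point -/

namespace FirstOccurrence

open Equiv Equiv.Perm

variable {l : ℕ} {K : Subgroup (Perm (Fin l))} {s : Perm (Fin (l + 1))} {κ : Perm (Fin l)}

theorem val_delPerm_zero (s : Perm (Fin (l + 1))) (j : Fin l) :
    (delPerm s 0 j : ℕ) = if (s j.succ : ℕ) < s 0 then (s j.succ : ℕ) else s j.succ - 1 := by
  rw [val_delPerm, Fin.succAbove_zero]

/-- If `s b.succ < s 0`, the merge drops the value `s 0`, as `delPerm s 0` does. If `s b.succ = s 0
+ 1`, dropping either value renumbers the rest alike. Only the domain is renumbered, by a cycle. -/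
theorem mergePerm_zero_eq {b : Fin l} (hb : (s b.succ : ℕ) < s 0 ∨ (s b.succ : ℕ) = s 0 + 1) :
    mergePerm s 0 b.succ = delPerm s 0 * (b.cycleRange)⁻¹ := by
  ext i
  have hne : ∀ x y : Fin (l + 1), x ≠ y → (s x : ℕ) ≠ s y :=
    fun x y h e => h (s.injective (Fin.ext e))
  have hj := val_cycleRange_inv b i
  rw [Perm.mul_apply, val_delPerm_zero]
  generalize (b.cycleRange⁻¹ : Perm (Fin l)) i = j at hj ⊢
  have hx := val_succAbove b.succ i
  rw [Fin.val_succ] at hx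
  have hb0 : b.succ ≠ 0 := Fin.succ_ne_zero b
  by_cases hi : (i : ℕ) = 0
  · have e1 : b.succ.succAbove i = 0 := Fin.ext (by rw [hx, if_pos (by omega), hi]; rfl)
    have e2 : j = b := Fin.ext (by rw [hj, if_pos hi])
    subst e2
    rcases hb with hb | hb
    · rw [mergePerm_of_gt hb, val_delPerm, e1, Perm.mul_apply, Perm.mul_apply, swap_apply_left,
        swap_apply_right]
    · rw [mergePerm_of_lt (by rw [Fin.lt_def]; omega), val_delPerm, e1]
      split_ifs <;> omega
  · have e1 : b.succ.succAbove i = j.succ := by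
      ext
      rw [hx, Fin.val_succ, hj]
      split_ifs <;> omega
    have hj0 : j.succ ≠ 0 := Fin.succ_ne_zero j
    have hjb : j.succ ≠ b.succ := e1 ▸ Fin.succAbove_ne b.succ i
    rcases hb with hb | hb
    · rw [mergePerm_of_gt hb, val_delPerm, e1, Perm.mul_apply, Perm.mul_apply, swap_apply_right,
        swap_apply_of_ne_of_ne hj0 hjb]
    · rw [mergePerm_of_lt (by rw [Fin.lt_def]; omega), val_delPerm, e1]
      have h1 := hne _ _ hj0
      have h2 := hne _ _ hjb
      split_ifs <;> omega

/-- The three-cycles obtained from merging the first point with three other points. -/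
theorem three_mem_of_merge (hρ : ∀ u v, u < v → mergePerm s u v * κ⁻¹ ∈ K) {b₁ b₂ b₃ : Fin l}
    (h1 : (s b₁.succ : ℕ) < s 0 ∨ (s b₁.succ : ℕ) = s 0 + 1)
    (h2 : (s b₂.succ : ℕ) < s 0 ∨ (s b₂.succ : ℕ) = s 0 + 1)
    (h3 : (s b₃.succ : ℕ) < s 0 ∨ (s b₃.succ : ℕ) = s 0 + 1)
    (h12 : b₁ ≠ b₂) (h13 : b₁ ≠ b₃) (h23 : b₂ ≠ b₃) :
    swap (delPerm s 0 b₁) (delPerm s 0 b₂) * swap (delPerm s 0 b₂) (delPerm s 0 b₃) ∈ K := by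
  set D := delPerm s 0 with hD
  have hsorted : ∀ b₁ b₂ b₃ : Fin l, b₁ < b₂ → b₂ < b₃ →
      ((s b₁.succ : ℕ) < s 0 ∨ (s b₁.succ : ℕ) = s 0 + 1) →
      ((s b₂.succ : ℕ) < s 0 ∨ (s b₂.succ : ℕ) = s 0 + 1) →
      ((s b₃.succ : ℕ) < s 0 ∨ (s b₃.succ : ℕ) = s 0 + 1) →
      swap (D b₂) (D b₁) * swap (D b₁) (D b₃) ∈ K := by
    intro b₁ b₂ b₃ h12 h23 h1 h2 h3
    have m1 := hρ 0 b₁.succ (Fin.succ_pos _)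
    have m2 := hρ 0 b₂.succ (Fin.succ_pos _)
    have m3 := hρ 0 b₃.succ (Fin.succ_pos _)
    rw [mergePerm_zero_eq h1] at m1
    rw [mergePerm_zero_eq h2] at m2
    rw [mergePerm_zero_eq h3] at m3
    -- This product of quotients is the conjugate by `D` of the product in `cycleRange_commutator`.
    have h := K.mul_mem (K.mul_mem (mul_inv_mem_of_coset m1 m2) (mul_inv_mem_of_coset m3 m1))
      (mul_inv_mem_of_coset m2 m3)
    rw [swap_apply_apply D b₂ b₁, swap_apply_apply D b₁ b₃]
    have e : D * swap b₂ b₁ * D⁻¹ * (D * swap b₁ b₃ * D⁻¹) =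
        D * (swap b₂ b₁ * swap b₁ b₃) * D⁻¹ := by group
    rw [e, ← cycleRange_commutator h12 h23]
    simpa [mul_assoc] using h
  have hinj : ∀ {x y : Fin l}, x ≠ y → D x ≠ D y := fun h => D.injective.ne h
  have n12 := hinj h12
  have n13 := hinj h13
  have n23 := hinj h23
  rcases lt_or_gt_of_ne h12 with a | a <;> rcases lt_or_gt_of_ne h13 with b | b <;>
    rcases lt_or_gt_of_ne h23 with c | c
  · exact three_reverse n23 n13 (hsorted _ _ _ a c h1 h2 h3)
  · exact three_rotate n23.symm n13.symm (hsorted _ _ _ b c h1 h3 h2)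
  · exact absurd (a.trans (c.trans b)) (lt_irrefl _)
  · exact three_reverse n23 n13 (three_rotate n13.symm n23.symm
      (three_rotate n12 n13 (hsorted _ _ _ b a h3 h1 h2)))
  · exact hsorted _ _ _ a b h2 h1 h3
  · exact absurd (b.trans (c.trans a)) (lt_irrefl _)
  · exact three_reverse n23 n13 (three_rotate n13.symm n23.symm (hsorted _ _ _ c b h2 h3 h1))
  · exact three_rotate n23.symm n13.symm (three_rotate n12.symm n23 (hsorted _ _ _ c a h3 h2 h1))

/-- Deleting a point of an invariant initial segment only affects this segment. -/
theorem delPerm_lt_of_lt {e : ℕ} (hpref : ∀ x : Fin (l + 1), (x : ℕ) < e ↔ (s x : ℕ) < e)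
    {v : Fin (l + 1)} (hv : (v : ℕ) < e) {i : Fin l} (hi : (i : ℕ) + 1 < e) :
    (delPerm s v i : ℕ) + 1 < e := by
  have h1 := val_delPerm s v i
  have h2 := val_succAbove v i
  have h3 := (hpref v).1 hv
  have h4 := (hpref (v.succAbove i)).1 (by rw [h2]; split_ifs <;> omega)
  split_ifs at h1 <;> omega

theorem val_delPerm_of_ge {e : ℕ} (hpref : ∀ x : Fin (l + 1), (x : ℕ) < e ↔ (s x : ℕ) < e)
    {v : Fin (l + 1)} (hv : (v : ℕ) < e) {i : Fin l} (hi : e ≤ (i : ℕ) + 1) :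
    (delPerm s v i : ℕ) = s i.succ - 1 := by
  have h1 := val_delPerm s v i
  have h2 := val_succAbove v i
  have h3 := (hpref v).1 hv
  have e1 : v.succAbove i = i.succ := Fin.ext (by rw [h2, Fin.val_succ]; split_ifs <;> omega)
  rw [e1] at h1
  have h4 := (hpref i.succ).not.1 (by rw [Fin.val_succ]; omega)
  rw [h1, if_neg (by omega)]

theorem delPerm_mul_inv_apply {e : ℕ} {s' : Perm (Fin (l + 1))}
    (hpref : ∀ x : Fin (l + 1), (x : ℕ) < e ↔ (s x : ℕ) < e)
    (hpref' : ∀ x : Fin (l + 1), (x : ℕ) < e ↔ (s' x : ℕ) < e)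
    (heq : ∀ x : Fin (l + 1), e ≤ (x : ℕ) → s x = s' x)
    {v v' : Fin (l + 1)} (hv : (v : ℕ) < e) (hv' : (v' : ℕ) < e) (x : Fin l) :
    (delPerm s v * (delPerm s' v')⁻¹) x = x ∨
      ((x : ℕ) + 1 < e ∧ ((delPerm s v * (delPerm s' v')⁻¹) x : ℕ) + 1 < e) := by
  obtain ⟨i, rfl⟩ := (delPerm s' v').surjective x
  rw [Perm.mul_apply, Perm.inv_def, symm_apply_apply]
  rcases Nat.lt_or_ge ((i : ℕ) + 1) e with hi | hi
  · exact Or.inr ⟨delPerm_lt_of_lt hpref' hv' hi, delPerm_lt_of_lt hpref hv hi⟩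
  · left
    ext
    rw [val_delPerm_of_ge hpref hv hi, val_delPerm_of_ge hpref' hv' hi,
      heq _ (by rw [Fin.val_succ]; omega)]

theorem swap_preserves {e : ℕ} (hpref : ∀ x : Fin (l + 1), (x : ℕ) < e ↔ (s x : ℕ) < e)
    {u v : Fin (l + 1)} (hu : (u : ℕ) < e) (hv : (v : ℕ) < e) :
    (∀ x : Fin (l + 1), (x : ℕ) < e ↔ ((s * swap u v) x : ℕ) < e) ∧
      ∀ x : Fin (l + 1), e ≤ (x : ℕ) → (s * swap u v) x = s x := by
  refine ⟨fun x => ?_, fun x hx => ?_⟩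
  · rw [Perm.mul_apply, ← hpref]
    rw [swap_apply_def]
    split_ifs with h1 h2
    · subst h1; exact iff_of_true hu hv
    · subst h2; exact iff_of_true hv hu
    · rfl
  · rw [Perm.mul_apply, swap_apply_of_ne_of_ne]
    · rintro rfl; omega
    · rintro rfl; omega

end FirstOccurrence

/-! ### First point sent to at least 2 -/

namespace FirstOccurrence

open Equiv Equiv.Perm

variable {l : ℕ} {K : Subgroup (Perm (Fin l))} {s : Perm (Fin (l + 1))} {κ : Perm (Fin l)}

/-- After deletion of `0`, the values up to `s 0` come exactly from the points to which
`mergePerm_zero_eq` applies. -/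
theorem mem_threeSet_of_le (hl : 2 ≤ l) (hP : 2 ≤ (s 0 : ℕ))
    (hρ : ∀ u v, u < v → mergePerm s u v * κ⁻¹ ∈ K) (x : Fin l) (hx : (x : ℕ) ≤ s 0) :
    x ∈ threeSet K ⟨0, by omega⟩ ⟨1, by omega⟩ := by
  have key : ∀ y : Fin l, (y : ℕ) ≤ s 0 → ∃ b, delPerm s 0 b = y ∧
      ((s b.succ : ℕ) < s 0 ∨ (s b.succ : ℕ) = s 0 + 1) := by
    intro y hy
    obtain ⟨b, rfl⟩ := (delPerm s 0).surjective y
    refine ⟨b, rfl, ?_⟩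
    rw [val_delPerm_zero] at hy
    have : (s b.succ : ℕ) ≠ s 0 := fun h => Fin.succ_ne_zero b (s.injective (Fin.ext h))
    split_ifs at hy <;> omega
  obtain ⟨b, hb, hb'⟩ := key x hx
  obtain ⟨b₀, hb₀, hb₀'⟩ := key ⟨0, by omega⟩ (by simp only; omega)
  obtain ⟨b₁, hb₁, hb₁'⟩ := key ⟨1, by omega⟩ (by simp only; omega)
  by_cases h0 : x = ⟨0, by omega⟩
  · exact Or.inl h0
  by_cases h1 : x = ⟨1, by omega⟩
  · exact Or.inr (Or.inl h1)
  refine Or.inr (Or.inr ?_)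
  rw [← hb, ← hb₀, ← hb₁]
  refine three_mem_of_merge hρ hb₀' hb₁' hb' ?_ ?_ ?_
  · rintro rfl
    have := hb₀.symm.trans hb₁
    simp at this
  · rintro rfl; exact h0 (hb.symm.trans hb₀)
  · rintro rfl; exact h1 (hb.symm.trans hb₁)

/-- One step of the extension of the set of points on which `K` contains all even
permutations. -/
theorem mem_threeSet_of_inversion (hl : 2 ≤ l) (hP : 2 ≤ (s 0 : ℕ))
    (hρ : ∀ u v, u < v → mergePerm s u v * κ⁻¹ ∈ K) {k : ℕ} (hk : k < l) (hPk : (s 0 : ℕ) < k)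
    {u v : Fin (l + 1)} (huv : u < v) (hv : (s v : ℕ) < k) (hu : k < (s u : ℕ))
    (ih : ∀ x : Fin l, (x : ℕ) < k → x ∈ threeSet K ⟨0, by omega⟩ ⟨1, by omega⟩) :
    (⟨k, hk⟩ : Fin l) ∈ threeSet K ⟨0, by omega⟩ ⟨1, by omega⟩ := by
  have hv0 : (0 : Fin (l + 1)) < v := lt_of_le_of_lt (Fin.zero_le u) huv
  set ρ := mergePerm s 0 v with hρdef
  set ρ' := mergePerm s u v with hρ'def
  -- Comparing the merges of `v` with `u` and with `0`: this element of `K` sends `k - 1` to `k`,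
  -- because the value `k` is lowered by the second merge only.
  have hπ := mul_inv_mem_of_coset (hρ u v huv) (hρ 0 v hv0)
  rw [← hρdef, ← hρ'def] at hπ
  have happ : ∀ j, (ρ' * ρ⁻¹) (ρ j) = ρ' j := fun j => by
    rw [Perm.mul_apply, Perm.inv_def, symm_apply_apply]
  have hu0 : (u : Fin (l + 1)) ≠ 0 := by rintro rfl; omega
  have hsv0 : (s v : ℕ) ≠ s 0 := fun h => hv0.ne' (s.injective (Fin.ext h))
  have hρ'v : ∀ j, v.succAbove j ≠ u → (s (v.succAbove j) : ℕ) ≤ k →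
      (ρ' j : ℕ) = s (v.succAbove j) := by
    intro j hj hjk
    rw [hρ'def, mergePerm_of_gt (by rw [Fin.lt_def]; omega), val_delPerm, Perm.mul_apply,
      Perm.mul_apply, swap_apply_right, swap_apply_of_ne_of_ne hj (Fin.succAbove_ne v j),
      if_pos (by omega)]
  have hρv : ∀ j, (s (v.succAbove j) : ℕ) < k → (ρ j : ℕ) < k := by
    intro j hjk
    rcases Nat.lt_or_ge (s v) (s 0) with h | h
    · rw [hρdef, mergePerm_of_gt h, val_delPerm, Perm.mul_apply, Perm.mul_apply, swap_apply_right]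
      by_cases h0 : v.succAbove j = 0
      · rw [h0, swap_apply_left]
        split_ifs <;> omega
      · rw [swap_apply_of_ne_of_ne h0 (Fin.succAbove_ne v j)]
        split_ifs <;> omega
    · rw [hρdef, mergePerm_of_lt (by rw [Fin.lt_def]; omega), val_delPerm]
      split_ifs <;> omega
  have hρk : ∀ j, (s (v.succAbove j) : ℕ) = k → (ρ j : ℕ) = k - 1 := by
    intro j hjk
    have h0 : v.succAbove j ≠ 0 := fun h => by rw [h] at hjk; omega
    rcases Nat.lt_or_ge (s v) (s 0) with h | h
    · rw [hρdef, mergePerm_of_gt h, val_delPerm, Perm.mul_apply, Perm.mul_apply, swap_apply_right,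
        swap_apply_of_ne_of_ne h0 (Fin.succAbove_ne v j)]
      split_ifs <;> omega
    · rw [hρdef, mergePerm_of_lt (by rw [Fin.lt_def]; omega), val_delPerm]
      split_ifs <;> omega
  have hex : ∀ t, t ≤ k → t ≠ s v → ∃ j, (s (v.succAbove j) : ℕ) = t ∧ v.succAbove j ≠ u := by
    intro t ht htv
    obtain ⟨x, hx⟩ := s.surjective ⟨t, by omega⟩
    have hxv : x ≠ v := by rintro rfl; rw [hx] at htv; simp at htv
    obtain ⟨j, rfl⟩ := Fin.exists_succAbove_eq hxv
    refine ⟨j, by rw [hx], fun h => ?_⟩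
    rw [h] at hx
    rw [hx] at hu
    simp only at hu
    omega
  -- Two values other than `s v` whose points have images below `k` under both merges, as
  -- `map_mem_threeSet` requires. They exist among `0, 1, 2` since `k > s 0 ≥ 2`.
  obtain ⟨t₁, t₂, ht₁, ht₂, ht₁v, ht₂v, ht⟩ :
      ∃ t₁ t₂, t₁ < 3 ∧ t₂ < 3 ∧ t₁ ≠ (s v : ℕ) ∧ t₂ ≠ (s v : ℕ) ∧ t₁ ≠ t₂ := by
    rcases Nat.eq_zero_or_pos (s v : ℕ) with h | h
    · exact ⟨1, 2, by omega, by omega, by omega, by omega, by omega⟩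
    · rcases eq_or_ne (s v : ℕ) 1 with h' | h'
      · exact ⟨0, 2, by omega, by omega, by omega, by omega, by omega⟩
      · exact ⟨0, 1, by omega, by omega, by omega, by omega, by omega⟩
  obtain ⟨j, hj, hju⟩ := hex k le_rfl (by omega)
  obtain ⟨j₁, hj₁, hju₁⟩ := hex t₁ (by omega) ht₁v
  obtain ⟨j₂, hj₂, hju₂⟩ := hex t₂ (by omega) ht₂v
  have e0 : ρ' j = ⟨k, hk⟩ := Fin.ext (by rw [hρ'v j hju (by omega), hj])
  have e1 := hρ'v j₁ hju₁ (by omega)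
  have e2 := hρ'v j₂ hju₂ (by omega)
  have hab : (⟨0, by omega⟩ : Fin l) ≠ ⟨1, by omega⟩ := by simp
  have n2 : j ≠ j₂ := by rintro rfl; omega
  have n12 : j₁ ≠ j₂ := by rintro rfl; omega
  have := map_mem_threeSet hab hπ (i := ρ j) (j := ρ j₁) (k := ρ j₂) (ρ.injective.ne n2)
    (ρ.injective.ne n12) (ih _ (by rw [hρk j hj]; omega)) (ih _ (hρv _ (by omega)))
    (ih _ (hρv _ (by omega))) (by rw [happ]; exact ih _ (by omega))
    (by rw [happ]; exact ih _ (by omega))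
  rwa [happ, e0] at this

/-- If `s` maps the first point to at least `2`, then the deletions of all points lie in the coset
containing the merges. -/
theorem delPerm_mem_of_two_le (hP : 2 ≤ (s 0 : ℕ))
    (hρ : ∀ u v, u < v → mergePerm s u v * κ⁻¹ ∈ K) (v : Fin (l + 1)) :
    delPerm s v * κ⁻¹ ∈ K := by
  classical
  have hl : 2 ≤ l := by have := (s 0).2; omega
  have hS : ∀ x, l < x → natPerm s x = x := fun x hx => natPerm_of_ge s hx
  have hex : ∃ e, 1 ≤ e ∧ ∀ x, x < e ↔ natPerm s x < e := by
    refine ⟨l + 1, by omega, fun x => ⟨fun hx => ?_, fun hx => ?_⟩⟩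
    · have := apply_le_of_le hS (x := x) (by omega)
      omega
    · by_contra h
      have := hS x (by omega)
      omega
  -- `[0, e)` is the first block of `s`. By minimality, an inversion passes over every `k` with `0 <
  -- k` and `k + 1 < e`, so the three-cycles extend over the whole block with one point removed.
  obtain ⟨e, ⟨he1, hprefN⟩, hmin⟩ : ∃ e, (1 ≤ e ∧ ∀ x, x < e ↔ natPerm s x < e) ∧
      ∀ m, m < e → ¬ (1 ≤ m ∧ ∀ x, x < m ↔ natPerm s x < m) :=
    ⟨Nat.find hex, Nat.find_spec hex, fun m hm => Nat.find_min hex hm⟩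
  have hpref : ∀ x : Fin (l + 1), (x : ℕ) < e ↔ (s x : ℕ) < e := by
    intro x
    rw [hprefN x, natPerm_val]
  have hPe : (s 0 : ℕ) < e := (hpref 0).1 (by rw [Fin.val_zero]; omega)
  have hel : e ≤ l + 1 := by
    by_contra h
    refine hmin (l + 1) (by omega) ⟨by omega, fun x => ⟨fun hx => ?_, fun hx => ?_⟩⟩
    · have := apply_le_of_le hS (x := x) (by omega)
      omega
    · by_contra h
      have := hS x (by omega)
      omega
  have hab : (⟨0, by omega⟩ : Fin l) ≠ ⟨1, by omega⟩ := by simp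
  have hT : ∀ k, ∀ x : Fin l, (x : ℕ) < k → (x : ℕ) + 1 < e →
      x ∈ threeSet K ⟨0, by omega⟩ ⟨1, by omega⟩ := by
    intro k
    induction k with
    | zero => intro x hx; omega
    | succ k ih =>
      intro x hx hxe
      rcases Nat.lt_or_ge (x : ℕ) k with h | h
      · exact ih x h hxe
      have hxk : (x : ℕ) = k := by omega
      rcases Nat.lt_or_ge (s 0 : ℕ) x with hx0 | hx0
      · obtain ⟨u, v, huv, hv, hu⟩ := exists_inversion_over (S := natPerm s) (k := x)
          (fun h => hmin x (by omega) ⟨by omega, h⟩) (fun h => hmin (x + 1) hxe ⟨by omega, h⟩)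
        have hvl : v < l + 1 := by
          by_contra hlt
          rw [natPerm_of_ge s (by omega)] at hv
          omega
        rw [natPerm_of_lt s hvl] at hv
        rw [natPerm_of_lt s (show u < l + 1 by omega)] at hu
        exact mem_threeSet_of_inversion hl hP hρ x.2 hx0 (u := ⟨u, by omega⟩) (v := ⟨v, hvl⟩) huv hv
          hu fun y hy => ih y (by omega) (by omega)
      · exact mem_threeSet_of_le hl hP hρ x hx0
  have hT : ∀ x : Fin l, (x : ℕ) + 1 < e → x ∈ threeSet K ⟨0, by omega⟩ ⟨1, by omega⟩ :=
    fun x hx => hT (x + 1) x (by omega) hx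
  -- every merge of two points of the first block is a deletion for a permutation of this block
  have hblock : ∀ v : Fin (l + 1), (v : ℕ) < e → ∃ s' : Perm (Fin (l + 1)),
      (∀ x : Fin (l + 1), (x : ℕ) < e ↔ (s' x : ℕ) < e) ∧
      (∀ x : Fin (l + 1), e ≤ (x : ℕ) → s' x = s x) ∧ mergePerm s 0 v = delPerm s' v := by
    intro v hv
    have h := swap_preserves hpref (u := 0) (v := v) (by rw [Fin.val_zero]; omega) hv
    rw [mergePerm]
    split_ifs
    · exact ⟨s, hpref, fun _ _ => rfl, rfl⟩
    · exact ⟨s * swap 0 v, h.1, h.2, rfl⟩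
  -- Otherwise all merges of `0` within the block have the same sign, since their quotients move
  -- only points of `threeSet`. `parity_count` excludes this.
  have hswap : swap (⟨0, by omega⟩ : Fin l) ⟨1, by omega⟩ ∈ K := by
    by_contra hno
    have hconst : ∀ v : Fin (l + 1), 0 < v → (v : ℕ) < e →
        sign (mergePerm s 0 v) = sign (mergePerm s 0 ⟨1, by omega⟩) := by
      intro v hv0 hv
      by_contra hne
      obtain ⟨s₁, h1, h2, h3⟩ := hblock v hv
      obtain ⟨s₂, h1', h2', h3'⟩ := hblock ⟨1, by omega⟩ (by simp only; omega)
      refine hno (swap_mem_of_sign_ne_one hab (mul_inv_mem_of_coset (hρ 0 v hv0)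
        (hρ 0 ⟨1, by omega⟩ (by simp [Fin.lt_def]))) ?_ ?_)
      · rw [Perm.sign_mul, sign_inv]
        intro h
        apply hne
        rw [mul_eq_one_iff_eq_inv] at h
        rw [h, Int.units_inv_eq_self]
      · intro x hx
        rw [h3, h3'] at hx
        have hlt : ((⟨1, by omega⟩ : Fin (l + 1)) : ℕ) < e := by simp only; omega
        rcases delPerm_mul_inv_apply h1 h1' (fun x hx => (h2 x hx).trans (h2' x hx).symm) hv
          hlt x with h | h
        · exact absurd h hx
        · exact hT x h.1
    generalize sign (mergePerm s 0 ⟨1, by omega⟩) = ε₀ at hconst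
    have hz : ∀ x y : ℤˣ, x = y → (x : ℤ) = y := fun x y h => by rw [h]
    refine parity_count hprefN (P := s 0) (natPerm_val s 0) hP hPe ((ε₀ * sign s : ℤˣ) : ℤ) ?_ ?_ ?_
    · rcases Int.units_eq_one_or (ε₀ * sign s) with h | h <;> simp [h]
    · intro x hx hxP
      have hxl : x < l + 1 := by omega
      rw [natPerm_of_lt s hxl] at hxP
      have hx0 : (0 : Fin (l + 1)) < ⟨x, hxl⟩ := by
        rw [Fin.pos_iff_ne_zero]
        intro h
        rw [h] at hxP
        omega
      have h := hconst ⟨x, hxl⟩ hx0 hx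
      rw [mergePerm_of_gt hxP, sign_delPerm, Perm.sign_mul, sign_swap hx0.ne, Perm.mul_apply,
        swap_apply_right, pow_add] at h
      have h' : (-1 : ℤˣ) ^ x = -(ε₀ * sign s) * (-1) ^ (s 0 : ℕ) := by
        rw [← h]
        have e1 : (-1 : ℤˣ) ^ (s 0 : ℕ) * (-1) ^ (s 0 : ℕ) = 1 := by rw [← mul_pow]; simp
        have e2 : sign s * sign s = 1 := Int.units_mul_self _
        generalize (-1 : ℤˣ) ^ (s 0 : ℕ) = p at *
        simp only [mul_neg, neg_mul, mul_one, neg_neg]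
        calc (-1 : ℤˣ) ^ x = (-1) ^ x * (p * p) * (sign s * sign s) := by rw [e1, e2]; simp
          _ = _ := by ac_rfl
      have := hz _ _ h'
      push_cast at this ⊢
      exact this
    · intro x hx hxP
      have hxl : x < l + 1 := by omega
      rw [natPerm_of_lt s hxl] at hxP ⊢
      have hx0 : (0 : Fin (l + 1)) < ⟨x, hxl⟩ := by
        rw [Fin.pos_iff_ne_zero]
        intro h
        rw [h] at hxP
        omega
      have h := hconst ⟨x, hxl⟩ hx0 hx
      rw [mergePerm_of_lt hxP, sign_delPerm, pow_add] at h
      have h' : (-1 : ℤˣ) ^ x = (ε₀ * sign s) * (-1) ^ (s ⟨x, hxl⟩ : ℕ) := by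
        rw [← h]
        have e1 : (-1 : ℤˣ) ^ (s ⟨x, hxl⟩ : ℕ) * (-1) ^ (s ⟨x, hxl⟩ : ℕ) = 1 := by
          rw [← mul_pow]; simp
        have e2 : sign s * sign s = 1 := Int.units_mul_self _
        generalize (-1 : ℤˣ) ^ (s ⟨x, hxl⟩ : ℕ) = p at *
        calc (-1 : ℤˣ) ^ x = (-1) ^ x * (p * p) * (sign s * sign s) := by rw [e1, e2]; simp
          _ = _ := by ac_rfl
      have := hz _ _ h'
      push_cast at this ⊢
      exact this
  -- Inside the block, `K` contains the full symmetric group on the points `x` with `x + 1 < e`, so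
  -- a deletion and a merge differ by an element of `K`. Beyond it, `s 0 < s v` and the merge with
  -- `0` is the deletion of `v`.
  rcases Nat.lt_or_ge (v : ℕ) e with hv | hv
  · obtain ⟨s₂, h1', h2', h3'⟩ := hblock ⟨1, by omega⟩ (by simp only; omega)
    have hmem : delPerm s v * (delPerm s₂ ⟨1, by omega⟩)⁻¹ ∈ K := by
      refine mem_of_forall_swap_mem K _ fun x => ?_
      rcases delPerm_mul_inv_apply hpref h1' (fun x hx => (h2' x hx).symm) hv
        (show ((⟨1, by omega⟩ : Fin (l + 1)) : ℕ) < e by simp only; omega) x with h | h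
      · rw [h]; exact swap_self_mem x
      · exact swap_mem_trans (swap_mem_symm (swap_mem_of_mem_threeSet hswap (hT _ h.1)))
          (swap_mem_of_mem_threeSet hswap (hT _ h.2))
    have := K.mul_mem hmem (h3' ▸ hρ 0 ⟨1, by omega⟩ (by simp [Fin.lt_def]))
    simpa [mul_assoc] using this
  · have hv0 : (0 : Fin (l + 1)) < v := by
      rw [Fin.lt_def]; simp only [Fin.val_zero]; omega
    have h := hρ 0 v hv0
    rwa [mergePerm_of_lt] at h
    have := (hpref v).not.1 (by omega)
    rw [Fin.lt_def]
    omega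

end FirstOccurrence

/-! ### All merges in one coset -/

namespace FirstOccurrence

open Equiv Equiv.Perm

theorem IsPairs.mod_two {n o : ℕ} {s : Perm (Fin n)} (hs : IsPairs s o) (ho : o ≤ n) :
    (n - o) % 2 = 0 := by
  by_contra h
  have h1 := hs ⟨n - 1, by omega⟩
  have h2 := (s ⟨n - 1, by omega⟩).2
  simp only at h1
  rw [if_neg (by omega), if_pos (by omega)] at h1
  omega

theorem IsPairs.apply_apply {n o : ℕ} {s : Perm (Fin n)} (hs : IsPairs s o) (x : Fin n) :
    s (s x) = x := by
  have h1 := hs x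
  have h2 := hs (s x)
  apply Fin.ext
  split_ifs at h1 h2 <;> omega

theorem IsPairs.inv_eq {n o : ℕ} {s : Perm (Fin n)} (hs : IsPairs s o) : s⁻¹ = s :=
  Equiv.ext fun x => by rw [Perm.inv_eq_iff_eq, hs.apply_apply]

section Merge

variable {l : ℕ} {K : Subgroup (Perm (Fin l))} {s : Perm (Fin (l + 1))} {κ : Perm (Fin l)}

theorem mem_of_merge_of_delPerm {o : ℕ} (ho : o ≤ l)
    (hρ : ∀ u v, u < v → mergePerm s u v * κ⁻¹ ∈ K)
    (hfix : ∀ x : Fin (l + 1), (x : ℕ) < o → s x = x)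
    (hdel : ∀ v : Fin (l + 1), o ≤ v → delPerm s v * κ⁻¹ ∈ K)
    (hbad : IsPairs s o → (l + 1 - o) % 4 ≠ 0) : κ ∈ K := by
  rcases mem_or_isPairs ho hfix hdel
    (fun u v huv h => by rw [← mergePerm_of_gt h]; exact hρ u v huv) with h | h
  · exact h
  · have h2 := h.mod_two (by omega)
    have h4 := hbad h
    exact mem_of_isPairs ((l + 1 - o) / 2) (by omega) (by omega) h hdel

/-- If all merges of `s` lie in one coset of `K`, then this coset is `K` itself, unless `s` or its
inverse has an exceptional form. -/
theorem mem_of_merge (hl : 1 ≤ l) (hρ : ∀ u v, u < v → mergePerm s u v * κ⁻¹ ∈ K)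
    (h01 : (s 0 : ℕ) = 1 → (s⁻¹ 0 : Fin (l + 1)) = ⟨1, by omega⟩)
    (hbad : ∀ o, o ≤ 1 → IsPairs s o → (l + 1 - o) % 4 ≠ 0) : κ ∈ K := by
  have hpos : ∀ v : Fin (l + 1), 0 < (v : ℕ) → 0 < v := fun v h => by
    rw [Fin.lt_def, Fin.val_zero]; exact h
  have hne : ∀ x y : Fin (l + 1), x ≠ y → (s x : ℕ) ≠ s y :=
    fun x y h e => h (s.injective (Fin.ext e))
  rcases Nat.lt_or_ge (s 0 : ℕ) 2 with h2 | h2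
  · rcases Nat.lt_or_ge (s 0 : ℕ) 1 with h1 | h1
    · refine mem_of_merge_of_delPerm hl hρ (fun x hx => ?_) (fun v hv => ?_) (hbad 1 le_rfl)
      · have : x = 0 := Fin.ext (by rw [Fin.val_zero]; omega)
        subst this
        exact Fin.ext (by rw [Fin.val_zero]; omega)
      · have := hne 0 v (hpos v hv).ne
        rw [← mergePerm_of_lt (u := 0) (by rw [Fin.lt_def]; omega)]
        exact hρ 0 v (hpos v hv)
    -- Here `s` exchanges `0` and `1`, so their merge is the deletion of either. Any later `v` has
    -- `s v > s 0`, so its deletion is its merge with `0`.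
    · have hs0 : (s 0 : ℕ) = 1 := by omega
      have hs1 : (s ⟨1, by omega⟩ : ℕ) = 0 := by
        rw [← h01 hs0]; simp
      have hd0 : delPerm s 0 * κ⁻¹ ∈ K := by
        have := hρ 0 ⟨1, by omega⟩ (hpos _ Nat.one_pos)
        rwa [mergePerm_of_gt (by rw [Fin.lt_def]; omega),
          delPerm_succ_swap s 0 ⟨1, by omega⟩ (by simp)] at this
      have hd1 : delPerm s ⟨1, by omega⟩ = delPerm s 0 := by
        ext i
        rw [val_delPerm_zero, val_delPerm]
        rcases Nat.eq_zero_or_pos (i : ℕ) with hi | hi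
        · have e1 : (⟨1, by omega⟩ : Fin (l + 1)).succAbove i = 0 :=
            Fin.ext (by rw [val_succAbove, Fin.val_zero]; simp [hi])
          have e2 : i.succ = ⟨1, by omega⟩ := Fin.ext (by rw [Fin.val_succ, hi])
          rw [e1, e2, hs0, hs1]
          simp
        · have e1 : (⟨1, by omega⟩ : Fin (l + 1)).succAbove i = i.succ :=
            Fin.ext (by rw [val_succAbove, Fin.val_succ]; simp only; rw [if_neg (by omega)])
          have n0 := hne i.succ 0 (Fin.succ_ne_zero i)
          have n1 := hne i.succ ⟨1, by omega⟩ (fun h => by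
            have := congrArg Fin.val h
            rw [Fin.val_succ] at this
            simp only at this
            omega)
          rw [e1]
          split_ifs <;> omega
      refine mem_of_merge_of_delPerm (Nat.zero_le l) hρ (fun x hx => by omega) (fun v _ => ?_)
        (hbad 0 (by omega))
      rcases Nat.eq_zero_or_pos (v : ℕ) with hv | hv
      · rwa [show v = 0 from Fin.ext hv]
      · rcases eq_or_ne (v : ℕ) 1 with hv1 | hv1
        · rwa [show v = ⟨1, by omega⟩ from Fin.ext hv1, hd1]
        · have n0 := hne 0 v (hpos v hv).ne
          have n1 := hne ⟨1, by omega⟩ v (fun h => hv1 (congrArg Fin.val h).symm)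
          rw [← mergePerm_of_lt (u := 0) (by rw [Fin.lt_def]; omega)]
          exact hρ 0 v (hpos v hv)
  · exact mem_of_merge_of_delPerm (Nat.zero_le l) hρ (fun x hx => by omega)
      (fun v _ => delPerm_mem_of_two_le h2 hρ v) (hbad 0 (by omega))

end Merge

/-! ### Functions on permutations related by a rearrangement -/

section Compatible

variable {B : Type v} {n l : ℕ} {F G : Perm (Fin l) → B}

/-- `F` and `G` are functions of words with `l` distinct letters that agree on the orders of first
occurrence of each labelling `p` and of its rearrangement `p ∘ σ`. -/
def Compatible (σ : Perm (Fin n)) (F G : Perm (Fin l) → B) : Prop :=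
  ∀ (p : Fin n → Fin l) (π π' : Perm (Fin l)), IsOfo p π → IsOfo (p ∘ σ) π' → F π = G π'

theorem Compatible.symm {σ : Perm (Fin n)} (h : Compatible σ F G) : Compatible σ⁻¹ G F := by
  intro p π π' hp hp'
  refine (h (p ∘ ⇑σ⁻¹) π' π hp' ?_).symm
  have : (p ∘ ⇑σ⁻¹) ∘ ⇑σ = p := by ext x; simp
  rwa [this]

/-- If the points `u < v` carry the same label and the other labels are increasing, then
rearranging by `σ` changes the order of first occurrence by `mergePerm σ⁻¹ u v`. -/
theorem isOfo_comp_mergePerm (σ : Perm (Fin (l + 1))) {u v : Fin (l + 1)} (huv : u < v)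
    {p : Fin (l + 1) → Fin l} (hpv : p v = p u) (hps : ∀ i, p (v.succAbove i) = i) :
    IsOfo (p ∘ σ) ⇑(mergePerm σ⁻¹ u v)⁻¹ := by
  obtain ⟨i₀, rfl⟩ := Fin.exists_succAbove_eq huv.ne
  rw [hps] at hpv
  have key : ∀ s' : Perm (Fin (l + 1)), s' (v.succAbove i₀) < s' v →
      IsOfo (p ∘ ⇑s'⁻¹) ⇑(delPerm s' v)⁻¹ := by
    intro s' hs'
    refine ⟨(s' v).succAbove, Fin.strictMono_succAbove _, fun j => ?_, fun j => ?_⟩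
    · obtain ⟨i, rfl⟩ := (delPerm s' v).surjective j
      simp [succAbove_delPerm, hps]
    · obtain ⟨x, rfl⟩ := s'.surjective j
      rcases eq_or_ne x v with rfl | hx
      · refine ⟨delPerm s' x i₀, by simp [hpv], ?_⟩
        rw [succAbove_delPerm]
        exact hs'.le
      · obtain ⟨i, rfl⟩ := Fin.exists_succAbove_eq hx
        exact ⟨delPerm s' v i, by simp [hps], (succAbove_delPerm s' v i).le⟩
  rcases lt_or_gt_of_ne ((σ⁻¹).injective.ne huv.ne) with hlt | hlt
  · rw [mergePerm_of_lt hlt]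
    simpa using key σ⁻¹ hlt
  · rw [mergePerm_of_gt hlt]
    have := key (σ⁻¹ * swap (v.succAbove i₀) v) (by simpa using hlt)
    convert this using 1
    funext x
    have hsw : ∀ y, p (swap (v.succAbove i₀) v y) = p y := by
      intro y
      rw [swap_apply_def]
      split_ifs with h1 h2
      · rw [h1, hpv, hps]
      · rw [h2, hpv, hps]
      · rfl
    simp [mul_inv_rev, hsw]

/-- Use the labelling that repeats at `v` the label of `u` and is increasing elsewhere, with its
labels renamed by `θ`. -/
theorem Compatible.eq_mergePerm {σ : Perm (Fin (l + 1))} (h : Compatible σ F G)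
    {u v : Fin (l + 1)} (huv : u < v) (θ : Perm (Fin l)) :
    F θ = G (θ * (mergePerm σ⁻¹ u v)⁻¹) := by
  obtain ⟨i₀, hi₀⟩ := Fin.exists_succAbove_eq huv.ne
  set p : Fin (l + 1) → Fin l := Fin.insertNth (α := fun _ => Fin l) v i₀ id with hp
  have hpv : p v = i₀ := by simp [hp]
  have hps : ∀ i, p (v.succAbove i) = i := fun i => by simp [hp]
  have h1 : IsOfo p id := by
    refine ⟨v.succAbove, Fin.strictMono_succAbove v, hps, fun j => ?_⟩
    rcases eq_or_ne j v with rfl | hj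
    · exact ⟨i₀, hpv, by rw [hi₀]; exact huv.le⟩
    · obtain ⟨i, rfl⟩ := Fin.exists_succAbove_eq hj
      exact ⟨i, hps i, le_rfl⟩
  have h2 := isOfo_comp_mergePerm σ huv (by rw [hpv, ← hi₀, hps]) hps
  exact h (θ ∘ p) θ (θ * (mergePerm σ⁻¹ u v)⁻¹) (h1.comp θ) (h2.comp θ)

/-- The right stabilizer of a function on permutations. -/
def rightStabilizer (G : Perm (Fin l) → B) : Subgroup (Perm (Fin l)) where
  carrier := {π | ∀ θ, G (θ * π) = G θ}
  one_mem' θ := by rw [mul_one]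
  mul_mem' {a b} ha hb θ := by rw [← mul_assoc, hb, ha]
  inv_mem' {a} ha θ := by rw [← ha (θ * a⁻¹), inv_mul_cancel_right]

/-- Two merges express the same `F`, so their quotient stabilizes `G`. The coset representative `κ`
is the merge of the first two points. -/
theorem Compatible.eq_of_inv {σ : Perm (Fin (l + 1))} (h : Compatible σ F G) (hl : 1 ≤ l)
    (h01 : (σ⁻¹ 0 : Fin (l + 1)) = ⟨1, by omega⟩ → σ 0 = ⟨1, by omega⟩)
    (hbad : ∀ o, o ≤ 1 → IsPairs σ⁻¹ o → (l + 1 - o) % 4 ≠ 0) : F = G := by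
  have h1 : (0 : Fin (l + 1)) < ⟨1, by omega⟩ := by rw [Fin.lt_def]; simp
  have hmem : mergePerm σ⁻¹ 0 ⟨1, by omega⟩ ∈ rightStabilizer G := by
    refine mem_of_merge (s := σ⁻¹) hl (fun u v huv θ => ?_)
      (fun h => by rw [inv_inv]; exact h01 (Fin.ext h)) hbad
    rw [← mul_assoc, ← h.eq_mergePerm h1, h.eq_mergePerm huv, mul_inv_cancel_right]
  funext θ
  rw [h.eq_mergePerm h1]
  exact (rightStabilizer G).inv_mem hmem θ

/-- The condition on `0` and `1` can fail for at most one of `σ` and `σ⁻¹`, and a pair exchange is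
its own inverse. -/
theorem Compatible.eq {σ : Perm (Fin (l + 1))} (h : Compatible σ F G) (hl : 1 ≤ l)
    (hbad : ∀ o, o ≤ 1 → IsPairs σ o → (l + 1 - o) % 4 ≠ 0) : F = G := by
  by_cases h01 : (σ⁻¹ 0 : Fin (l + 1)) = ⟨1, by omega⟩ → σ 0 = ⟨1, by omega⟩
  · refine h.eq_of_inv hl h01 fun o ho hp => hbad o ho ?_
    have := hp.inv_eq
    rw [inv_inv] at this
    rwa [this]
  · push Not at h01
    refine (h.symm.eq_of_inv hl (fun h => ?_) fun o ho hp => hbad o ho (by rwa [inv_inv] at hp)).symm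
    rw [inv_inv] at h
    exact absurd h h01.2

end Compatible

end FirstOccurrence

/-! ### Identifying coordinates and the sufficient condition -/

namespace FirstOccurrence

open Equiv Equiv.Perm

theorem IsOfo.apply_zero {X : Type*} {n l : ℕ} {p : Fin (n + 1) → X} {v : Fin (l + 1) → X}
    (h : IsOfo p v) : v 0 = p 0 := by
  obtain ⟨φ, hφ, h1, h2⟩ := h
  obtain ⟨i, hi, hi0⟩ := h2 0
  have : i = 0 := by
    have h3 : φ i ≤ φ 0 := hi0.trans (Fin.zero_le _)
    simpa using hφ.le_iff_le.1 h3
  rw [hi, this]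

theorem IsOfo.apply_one {X : Type*} {n l : ℕ} {p : Fin (n + 2) → X} {v : Fin (l + 2) → X}
    (h : IsOfo p v) (hp : p 1 ≠ p 0) : v 1 = p 1 := by
  have h0 := h.apply_zero
  obtain ⟨φ, hφ, h1, h2⟩ := h
  obtain ⟨i, hi, hi1⟩ := h2 1
  have hi0 : i ≠ 0 := by
    rintro rfl
    exact hp (hi.trans h0)
  have : ¬ 1 < i := by
    intro h1i
    have e1 := hφ h1i
    have e2 := hφ (show (0 : Fin (l + 2)) < 1 by simp)
    rw [Fin.lt_def] at e1 e2
    rw [Fin.le_def, Fin.val_one] at hi1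
    omega
  have : i = 1 := by
    rw [Fin.lt_def, Fin.val_one] at this
    have h3 : (i : ℕ) ≠ 0 := fun h => hi0 (Fin.ext h)
    exact Fin.ext (by rw [Fin.val_one]; omega)
  rw [hi, this]

theorem exists_surjective_labelling {n N : ℕ} (hN : 2 ≤ N) (hn : N + 1 ≤ n) {a b c : Fin n}
    (hca : c ≠ a) (hcb : c ≠ b) :
    ∃ m : Fin n → Fin N, Function.Surjective m ∧ m a = m b ∧ m c ≠ m a := by
  classical
  obtain ⟨T, hT1, hT2, hT3⟩ := Finset.exists_subsuperset_card_eq (n := N)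
    (s := ({a, c} : Finset (Fin n))) (t := insert a (Finset.univ.erase b))
    (by
      intro x hx
      rw [Finset.mem_insert, Finset.mem_singleton] at hx
      rcases hx with rfl | rfl <;> simp [hcb])
    (Finset.card_le_two.trans hN)
    (le_trans (by rw [Finset.card_erase_of_mem (Finset.mem_univ b), Finset.card_fin]; omega)
      (Finset.card_le_card (Finset.subset_insert a _)))
  have ha : a ∈ T := hT1 (by simp)
  have hc : c ∈ T := hT1 (by simp)
  let e : T ≃ Fin N := T.equivFinOfCardEq hT3
  refine ⟨fun x => if h : x ∈ T then e ⟨x, h⟩ else e ⟨a, ha⟩, fun y => ?_, ?_, ?_⟩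
  · refine ⟨(e.symm y : Fin n), ?_⟩
    simp
  · by_cases hb : b ∈ T
    · have : b = a := by
        have := hT2 hb
        simpa using this
      rw [this]
    · simp only [dif_pos ha, dif_neg hb]
  · simp only [dif_pos ha, dif_pos hc]
    intro h
    exact hca (congrArg Subtype.val (e.injective h))

section Reduction

variable {B : Type v} {n N l : ℕ} {F G : Perm (Fin l) → B}

/-- Labellings that factor through `m` only see the permutation relating the first occurrences of
`m` and `m ∘ σ`. -/
theorem Compatible.reduce {σ : Perm (Fin n)} (h : Compatible σ F G) {m : Fin n → Fin N}
    {π τ : Perm (Fin N)} (hπ : IsOfo m π) (hτ : IsOfo (m ∘ σ) τ) : Compatible (π⁻¹ * τ) F G := by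
  intro q θ θ' hq hq'
  refine h (q ∘ ⇑π⁻¹ ∘ m) θ θ' ?_ ?_
  · have := hπ.comp ⇑π⁻¹
    refine IsOfo.trans (q := q) this ?_
    simpa [Function.comp_def] using hq
  · have := hτ.comp ⇑π⁻¹
    exact IsOfo.trans (q := q) this hq'

/-- With `N = l + 1` classes, the form with `o = 1` is exceptional only for `N ≡ 1` modulo 4, and
that with `o = 0` only for `N ≡ 0`. A suitable `m` makes the reduced permutation fix or move `0`, or
fix `1`, as needed. The coordinate beyond `N` leaves room to identify a chosen pair. -/
theorem Compatible.eq_of_add_two_le {σ : Perm (Fin n)} (h : Compatible σ F G) (hl : 1 ≤ l)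
    (hn : l + 2 ≤ n) : F = G := by
  obtain ⟨n, rfl⟩ : ∃ n', n = n' + 2 := ⟨n - 2, by omega⟩
  obtain ⟨l, rfl⟩ : ∃ l', l = l' + 1 := ⟨l - 1, by omega⟩
  have key : ∀ m : Fin (n + 2) → Fin (l + 1 + 1), Function.Surjective m →
      (∀ τ π : Perm (Fin (l + 1 + 1)), IsOfo m π → IsOfo (m ∘ σ) τ →
        ∀ o, o ≤ 1 → IsPairs (π⁻¹ * τ) o → (l + 1 + 1 - o) % 4 ≠ 0) → F = G := by
    intro m hm hbad
    obtain ⟨π, hπ⟩ := exists_perm_isOfo m hm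
    obtain ⟨τ, hτ⟩ := exists_perm_isOfo (m ∘ σ) (hm.comp σ.surjective)
    exact (h.reduce hπ hτ).eq hl (hbad τ π hπ hτ)
  have hzero : ∀ (m : Fin (n + 2) → Fin (l + 1 + 1)) (τ π : Perm (Fin (l + 1 + 1))), IsOfo m π →
      IsOfo (m ∘ σ) τ → ((π⁻¹ * τ) 0 = 0 ↔ m 0 = m (σ 0)) := by
    intro m τ π hπ hτ
    rw [Perm.mul_apply, Perm.inv_eq_iff_eq, hπ.apply_zero, hτ.apply_zero, Function.comp, eq_comm]
  obtain ⟨c, hc0, hcσ⟩ : ∃ c : Fin (n + 2), c ≠ 0 ∧ c ≠ σ 0 := by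
    have hcard : ({0, σ 0} : Finset (Fin (n + 2))).card < Fintype.card (Fin (n + 2)) :=
      Finset.card_le_two.trans_lt (by rw [Fintype.card_fin]; omega)
    obtain ⟨c, hc⟩ := Finset.exists_mem_notMem_of_card_lt_card
      (s := ({0, σ 0} : Finset (Fin (n + 2)))) (t := Finset.univ) hcard
    refine ⟨c, ?_⟩
    simpa using hc
  by_cases h4 : (l + 1 + 1) % 4 = 1
  · by_cases hσ : σ 0 = 0
    · have hσ1 : (0 : Fin (n + 2)) ≠ σ 1 := by
        rw [← hσ]
        exact σ.injective.ne (by simp)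
      obtain ⟨m, hm, hm1, hm2⟩ := exists_surjective_labelling (N := l + 1 + 1) (by omega)
        (by omega) (a := 1) (b := σ 1) (c := (0 : Fin (n + 2))) (by simp) hσ1
      refine key m hm fun τ π hπ hτ o ho hp => ?_
      rcases Nat.lt_or_ge o 1 with ho1 | ho1
      · omega
      have h1 : (π⁻¹ * τ) 1 = 1 := by
        rw [Perm.mul_apply, Perm.inv_eq_iff_eq, hπ.apply_one hm2.symm, hτ.apply_one]
        · exact hm1.symm
        · rw [Function.comp, Function.comp, hσ, ← hm1]
          exact hm2.symm
      have h2 := hp 1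
      rw [h1, Fin.val_one, if_neg (by omega), if_pos (by omega)] at h2
      omega
    · obtain ⟨m, hm, -, hm2⟩ := exists_surjective_labelling (N := l + 1 + 1) (by omega)
        (by omega) (a := (0 : Fin (n + 2))) (b := 0) (c := σ 0) hσ hσ
      refine key m hm fun τ π hπ hτ o ho hp => ?_
      rcases Nat.lt_or_ge o 1 with ho1 | ho1
      · omega
      have h2 := hp 0
      rw [Fin.val_zero, if_pos (by omega)] at h2
      exact absurd ((hzero m τ π hπ hτ).1 (Fin.ext h2)) hm2.symm
  · obtain ⟨m, hm, hm1, -⟩ := exists_surjective_labelling (N := l + 1 + 1) (by omega)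
      (by omega) hc0 hcσ
    refine key m hm fun τ π hπ hτ o ho hp => ?_
    rcases Nat.lt_or_ge o 1 with ho1 | ho1
    · have h2 := hp 0
      rw [(hzero m τ π hπ hτ).2 hm1, Fin.val_zero, if_neg (by omega), if_pos (by omega)] at h2
      omega
    · omega

end Reduction

theorem equalizing_of_le (B : Type v) {n k : ℕ} (hk : 2 ≤ k)
    (h : (k % 4 = 1 ∨ k % 4 = 2) ∧ k + 1 ≤ n ∨ k + 2 ≤ n) : Equalizing.{u, v} B n k := by
  rintro A hA f g hf hg ⟨⟨σ, hσ⟩, τ, hτ⟩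
  by_cases hs : Function.Surjective σ
  · have hb : Function.Bijective σ := Finite.surjective_iff_bijective.1 hs
    obtain ⟨σ, rfl⟩ : ∃ e : Perm (Fin n), ⇑e = σ := ⟨Equiv.ofBijective σ hb, rfl⟩
    obtain ⟨fS, hfS⟩ := hf
    obtain ⟨gS, hgS⟩ := hg
    have : Finite A := Nat.finite_of_card_ne_zero (by omega)
    funext a
    obtain ⟨l, w, hw, ha⟩ := exists_isOfo a
    have hlk : l ≤ k := by
      rw [← hA]
      simpa using Nat.card_le_card_of_injective w hw
    have hl : 1 ≤ l := by
      obtain ⟨φ, -, -, h2⟩ := ha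
      have := (h2 ⟨0, by omega⟩).choose.2
      omega
    have hinj : ∀ π : Perm (Fin l), Function.Injective (w ∘ π) := fun π => hw.comp π.injective
    have hcomp : Compatible σ (fun π => fS ⟨List.ofFn (w ∘ π), List.nodup_ofFn.2 (hinj π)⟩)
        (fun π => gS ⟨List.ofFn (w ∘ π), List.nodup_ofFn.2 (hinj π)⟩) := by
      intro p π π' hp hp'
      dsimp only
      rw [← (hp.comp w).ofo_eq (hinj π), ← (hp'.comp w).ofo_eq (hinj π'), ← hfS, ← hgS, hσ]
      rfl
    have heq : (fun π : Perm (Fin l) => fS ⟨List.ofFn (w ∘ π), List.nodup_ofFn.2 (hinj π)⟩) =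
        fun π : Perm (Fin l) => gS ⟨List.ofFn (w ∘ π), List.nodup_ofFn.2 (hinj π)⟩ := by
      -- Only `l = k`, `n = k + 1` lands in the first case; then neither `k` nor `k + 1` is
      -- divisible by 4.
      rcases Nat.lt_or_ge n (l + 2) with hn | hn
      · obtain rfl : n = l + 1 := by omega
        exact hcomp.eq hl fun o ho _ => by omega
      · exact hcomp.eq_of_add_two_le hl hn
    rw [hfS, hgS, ha.ofo_eq hw]
    exact congrFun heq 1
  · exact eq_of_not_surjective (by omega) hf hg hσ hτ hs

end FirstOccurrence

/-! ### Counterexamples -/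

namespace FirstOccurrence

open Equiv Equiv.Perm

theorem isOfo_self {X : Type*} {n : ℕ} (c : Fin n → X) : IsOfo c c :=
  ⟨id, strictMono_id, fun _ => rfl, fun j => ⟨j, rfl, le_rfl⟩⟩

theorem strictMono_eq_id {n : ℕ} {φ : Fin n → Fin n} (hφ : StrictMono φ) : φ = id :=
  (hφ.range_inj strictMono_id).1 (by
    rw [(Finite.injective_iff_surjective.1 hφ.injective).range_eq, Set.range_id])

theorem IsOfo.eq_of_length_eq {X : Type*} {n : ℕ} {p v : Fin n → X} (h : IsOfo p v) : p = v := by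
  obtain ⟨φ, hφ, h1, -⟩ := h
  rw [strictMono_eq_id hφ] at h1
  exact funext h1

theorem isOfo_of_ofo_eq {A : Type u} {n l : ℕ} {a : Fin n → A} {w : Fin l → A}
    (h : (ofo a).1 = List.ofFn w) : IsOfo a w := by
  obtain ⟨l', v, hv, ha⟩ := exists_isOfo a
  rw [ha.ofo_eq hv] at h
  obtain rfl : l' = l := by simpa using congrArg List.length h
  rwa [← List.ofFn_injective h]

open Classical in
theorem determinedByOfo_indicator {A : Type u} {B : Type v} {n : ℕ} {c : Fin n → A}
    (hc : Function.Injective c) (b₀ b₁ : B) :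
    DeterminedByOfo fun a : Fin n → A => if a = c then b₁ else b₀ := by
  refine ⟨fun w => if w = ofo c then b₁ else b₀, fun a => ?_⟩
  have : ofo a = ofo c ↔ a = c := by
    refine ⟨fun h => ?_, fun h => by rw [h]⟩
    rw [(isOfo_self c).ofo_eq hc] at h
    exact (isOfo_of_ofo_eq (congrArg Subtype.val h)).eq_of_length_eq
  simp only [this]

/-- An injective `n`-tuple is the only tuple with its order of first occurrence. Its indicator and
that of the tuple with the first two entries exchanged are equivalent. -/
theorem not_equalizing_of_le (B : Type v) [Nontrivial B] {n k : ℕ} (hn : 2 ≤ n) (hnk : n ≤ k) :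
    ¬ Equalizing.{u, v} B n k := by
  classical
  intro h
  obtain ⟨b₀, b₁, hb⟩ := exists_pair_ne B
  set c : Fin n → ULift.{u} (Fin k) := fun i => ⟨Fin.castLE hnk i⟩ with hcdef
  have hc : Function.Injective c := fun i j hij =>
    Fin.castLE_injective hnk (congrArg ULift.down hij)
  set τ : Perm (Fin n) := swap ⟨0, by omega⟩ ⟨1, by omega⟩ with hτ
  have hττ : ∀ a : Fin n → ULift.{u} (Fin k), (a ∘ τ) ∘ τ = a := fun a => by
    funext x
    simp [hτ]
  have hiff : ∀ a b : Fin n → ULift.{u} (Fin k), a ∘ τ = b ↔ a = b ∘ τ := fun a b =>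
    ⟨fun h => by rw [← h, hττ], fun h => by rw [h, hττ]⟩
  have heq := h (ULift.{u} (Fin k)) (by simp) _ _ (determinedByOfo_indicator hc b₀ b₁)
    (determinedByOfo_indicator (hc.comp τ.injective) b₀ b₁)
    ⟨⟨τ, fun a => by simp only [hiff, hττ]; congr⟩, τ,
      fun a => by simp only [hiff]; congr⟩
  have h1 := congrFun heq c
  have hne : c ≠ c ∘ τ := fun e => by
    have := hc (congrFun e ⟨0, by omega⟩)
    simp [hτ] at this
  simp only [if_true, if_neg hne] at h1
  exact hb h1.symm

theorem exists_isPairs {n o : ℕ} (hno : (n - o) % 2 = 0) : ∃ s : Perm (Fin n), IsPairs s o := by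
  let F : Fin n → Fin n := fun x =>
    ⟨if (x : ℕ) < o then x else if ((x : ℕ) - o) % 2 = 0 then x + 1 else x - 1, by
      have := x.2
      split_ifs <;> omega⟩
  have hF : Function.Involutive F := by
    intro x
    apply Fin.ext
    simp only [F]
    split_ifs <;> omega
  exact ⟨hF.toPerm, fun x => rfl⟩

/-- Here `s` is even. In a non-inverted merge, `v` and `s v` differ by one. An inverted pair is an
exchanged pair, so `s * swap u v` is odd and fixes `v`. -/
theorem IsPairs.sign_mergePerm {l o h : ℕ} {s : Perm (Fin (l + 1))} (hs : IsPairs s o)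
    (ho : o ≤ 1) (hl : l + 1 = o + 2 * h) (hh : h % 2 = 0) {u v : Fin (l + 1)} (huv : u < v) :
    sign (mergePerm s u v) = -1 := by
  have hsign : sign s = 1 := by
    rw [hs.sign_eq hl, Even.neg_one_pow (Nat.even_iff.2 hh)]
  have hu := hs u
  have hv := hs v
  rw [Fin.lt_def] at huv
  rcases lt_or_gt_of_ne (s.injective.ne (Fin.ne_of_lt huv)) with hlt | hlt
  · rw [mergePerm_of_lt hlt, sign_delPerm, hsign, one_mul, Odd.neg_one_pow]
    rw [Nat.odd_iff]
    split_ifs at hv <;> omega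
  · have hsw : (s * swap u v) v = v := by
      rw [Perm.mul_apply, swap_apply_right]
      rw [Fin.lt_def] at hlt
      apply Fin.ext
      split_ifs at hu hv <;> omega
    rw [mergePerm_of_gt hlt, sign_delPerm, hsw, Perm.sign_mul, hsign,
      sign_swap (Fin.ne_of_lt huv), Even.neg_one_pow ⟨_, rfl⟩]
    rfl

/-- First occurrences fill all positions but one, `v`, whose label must occur earlier. -/
theorem IsOfo.exists_merge {l : ℕ} {p : Fin (l + 1) → Fin l} (h : IsOfo p id) :
    ∃ u v, u < v ∧ p v = p u ∧ ∀ i, p (v.succAbove i) = i := by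
  obtain ⟨φ, hφ, h1, h2⟩ := h
  obtain ⟨v, hv⟩ : ∃ v, ∀ i, φ i ≠ v := by
    by_contra! hc
    have := Fintype.card_le_of_surjective φ hc
    simp at this
  have hex : ∀ i, ∃ j, v.succAbove j = φ i := fun i => Fin.exists_succAbove_eq (hv i)
  choose ψ hψ using hex
  have hψm : StrictMono ψ := fun i j hij => by
    rw [← (Fin.strictMono_succAbove v).lt_iff_lt, hψ, hψ]
    exact hφ hij
  rw [strictMono_eq_id hψm] at hψ
  obtain ⟨i, hi, hle⟩ := h2 v
  exact ⟨φ i, v, lt_of_le_of_ne hle (hv i), by rw [hi, h1], fun i => by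
    have := hψ i
    rw [id] at this
    rw [this, h1, id]⟩

theorem IsPairs.sign_isOfo {l o h : ℕ} {s : Perm (Fin (l + 1))} (hs : IsPairs s o)
    (ho : o ≤ 1) (hl : l + 1 = o + 2 * h) (hh : h % 2 = 0) {p : Fin (l + 1) → Fin l}
    {π π' : Perm (Fin l)} (hp : IsOfo p π) (hp' : IsOfo (p ∘ s) π') : sign π' = - sign π := by
  have hq : IsOfo (⇑π⁻¹ ∘ p) id := by
    have := hp.comp ⇑π⁻¹
    rwa [show ⇑π⁻¹ ∘ ⇑π = id from funext fun x => by simp] at this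
  have hq' : IsOfo ((⇑π⁻¹ ∘ p) ∘ s) ⇑(π⁻¹ * π') := hp'.comp ⇑π⁻¹
  obtain ⟨u, v, huv, h1, h2⟩ := hq.exists_merge
  have hm := isOfo_comp_mergePerm s huv h1 h2
  have e : π⁻¹ * π' = (mergePerm s⁻¹ u v)⁻¹ := by
    apply DFunLike.coe_injective
    apply List.ofFn_injective
    rw [← hq'.ofoList_eq (Equiv.injective _), ← hm.ofoList_eq (Equiv.injective _)]
  rw [hs.inv_eq] at e
  rw [← mul_inv_cancel_left π π', e, Perm.sign_mul, sign_inv, hs.sign_mergePerm ho hl hh huv,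
    mul_neg, mul_one]

/-- `w` lists all elements of `Fin k` in the order given by a permutation of sign `ε`. -/
def IsSigned {k : ℕ} (ε : ℤˣ) (w : List (ULift.{u} (Fin k))) : Prop :=
  ∃ π : Perm (Fin k), sign π = ε ∧ w = List.ofFn fun i => ULift.up (π i)

/-- Rearranging by an even number of exchanged pairs reverses the sign of every order of first
occurrence that uses all `k` letters. The indicators of the two signs are thus equivalent, and they
differ. -/
theorem not_equalizing_succ (B : Type v) [Nontrivial B] {k : ℕ} (hk0 : 0 < k)
    (hk : k % 4 = 0 ∨ k % 4 = 3) :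
    ¬ Equalizing.{u, v} B (k + 1) k := by
  classical
  intro heq
  obtain ⟨b₀, b₁, hb⟩ := exists_pair_ne B
  obtain ⟨o, h, ho, hkh, hh⟩ : ∃ o h, o ≤ 1 ∧ k + 1 = o + 2 * h ∧ h % 2 = 0 := by
    rcases hk with hk | hk
    · exact ⟨1, k / 2, by omega, by omega, by omega⟩
    · exact ⟨0, (k + 1) / 2, by omega, by omega, by omega⟩
  obtain ⟨s, hs⟩ := exists_isPairs (n := k + 1) (o := o) (by omega)
  set f : ℤˣ → (Fin (k + 1) → ULift.{u} (Fin k)) → B :=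
    fun ε a => if IsSigned ε (ofo a).1 then b₁ else b₀ with hf
  have hdet : ∀ ε, DeterminedByOfo (f ε) := fun ε =>
    ⟨fun w => if IsSigned ε w.1 then b₁ else b₀, fun a => rfl⟩
  have hstep : ∀ ε (a : Fin (k + 1) → ULift.{u} (Fin k)), IsSigned ε (ofo a).1 →
      IsSigned (-ε) (ofo (a ∘ s)).1 := by
    rintro ε a ⟨π, hπ, hw⟩
    have hp := (isOfo_of_ofo_eq hw).comp ULift.down
    have hsurj : Function.Surjective (ULift.down ∘ a) := by
      intro y
      obtain ⟨φ, -, h1, -⟩ := hp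
      exact ⟨φ (π⁻¹ y), by rw [h1]; simp⟩
    obtain ⟨π', hp'⟩ := exists_perm_isOfo ((ULift.down ∘ a) ∘ s) (hsurj.comp s.surjective)
    refine ⟨π', by rw [← hπ]; exact hs.sign_isOfo ho hkh hh hp hp', ?_⟩
    exact (hp'.comp ULift.up).ofoList_eq (ULift.up_injective.comp π'.injective)
  have hss : ∀ a : Fin (k + 1) → ULift.{u} (Fin k), (a ∘ s) ∘ s = a := fun a => by
    funext x
    simp [hs.apply_apply]
  have hminor : ∀ ε, IsMinor (f ε) (f (-ε)) := by
    refine fun ε => ⟨s, fun a => ?_⟩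
    have : IsSigned ε (ofo a).1 ↔ IsSigned (-ε) (ofo (a ∘ s)).1 := by
      refine ⟨hstep ε a, fun h => ?_⟩
      have := hstep _ _ h
      rwa [hss, neg_neg] at this
    simp only [hf, this]
  have hEq := heq (ULift.{u} (Fin k)) (by simp) (f 1) (f (-1)) (hdet _) (hdet _)
    ⟨hminor 1, by simpa using hminor (-1)⟩
  set p : Fin (k + 1) → Fin k := Fin.snoc (α := fun _ => Fin k) id ⟨0, hk0⟩ with hp
  have hofo : IsOfo p id := by
    refine ⟨Fin.castSucc, Fin.strictMono_castSucc, fun i => by simp [hp], fun j => ?_⟩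
    induction j using Fin.lastCases with
    | last => exact ⟨⟨0, hk0⟩, by simp [hp], Fin.le_last _⟩
    | cast i => exact ⟨i, by simp [hp], le_rfl⟩
  have hw : (ofo (ULift.up.{u} ∘ p)).1 = List.ofFn (ULift.up.{u} ∘ id) :=
    (hofo.comp ULift.up).ofoList_eq ULift.up_injective
  have h1 : IsSigned 1 (ofo (ULift.up.{u} ∘ p)).1 := ⟨1, Perm.sign_one, hw⟩
  have h2 : ¬ IsSigned (-1) (ofo (ULift.up.{u} ∘ p)).1 := by
    rintro ⟨π, hπ, hw'⟩
    have hπ1 : π = 1 := by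
      ext i
      have := congrFun (List.ofFn_injective (hw'.symm.trans hw)) i
      simpa [Fin.ext_iff] using this
    rw [hπ1, Perm.sign_one] at hπ
    exact absurd hπ (by decide)
  have h3 := congrFun hEq (ULift.up.{u} ∘ p)
  simp only [hf, if_pos h1, if_neg h2] at h3
  exact hb h3.symm

end FirstOccurrence

/-! ### The main theorem -/

theorem mainTheorem1 (B : Type v) [Nontrivial B] (n k : ℕ) (hn : 2 ≤ n) (hk : 2 ≤ k) :
    FirstOccurrence.Equalizing.{u, v} B n k ↔
      ((k ≡ 1 [MOD 4] ∨ k ≡ 2 [MOD 4]) ∧ k + 1 ≤ n) ∨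
      ((k ≡ 0 [MOD 4] ∨ k ≡ 3 [MOD 4]) ∧ k + 2 ≤ n) := by
  simp only [Nat.ModEq]
  constructor
  · intro h
    have h1 : ¬ n ≤ k := fun hnk => FirstOccurrence.not_equalizing_of_le B hn hnk h
    have h2 : n = k + 1 → ¬ (k % 4 = 0 ∨ k % 4 = 3) := by
      rintro rfl hk4
      exact FirstOccurrence.not_equalizing_succ B (by omega) hk4 h
    omega
  · intro h
    exact FirstOccurrence.equalizing_of_le B hk (by omega)
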